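/- Let $n,m$ be natural numbers with $m\ge n$, let $p>n$ be a real number, let $\mathcal U\subset\mathbb R^n$ be a connected open set, and let $V\in C^1(\mathcal U,\mathbb R^n)$. Let $\varphi^t$ be the local flow on $\mathcal U$ generated by $\dot x=V(x)$. **Diffusion matrices and null families.** Let $\tilde{\mathcal A}$ be the class of matrix fields $A=(a^{ij})\in W^{1,p}_{loc}(\mathcal U,GL(n,\mathbb R))$ of the form $A=\frac12GG^\top$, where $G$ is an $n\times m$ matrix field on $\mathcal U$ of rank $n$ at every point with entries in $W^{1,2p}_{loc}(\mathcal U)$ (continuous representatives are used). A *null family* $\mathcal A=\{A_\alpha\}\subset\tilde{\mathcal A}$ is a net in $\tilde{\mathcal A}$, indexed by a nonempty directed set, that converges to the zero matrix in the topology of $W^{1,p}$-convergence on compact subsets of $\mathcal U$; below, $A\to0$ refers to this topology. Write $\mathcal L_A=a^{ij}\partial^2_{ij}+V^i\partial_i$. A *stationary measure* of $\mathcal L_A$ is a Borel probability measure $\nu$ on $\mathcal U$ with $\int_{\mathcal U}\mathcal L_Af\,d\nu=0$ for all $f\in C_0^\infty(\mathcal U)$. The family $\mathcal A$ is *admissible*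 if every $\mathcal L_{A_\alpha}$ has a stationary measure. An *$\mathcal A$-limit measure* is a Borel probability measure $\mu$ on $\mathcal U$ that is the limit, under weak convergence of probability measures on $\mathcal U$ (test functions in $C_b(\mathcal U)$), of a sequence of stationary measures $\nu_l$ of $\mathcal L_{A_l}$, where $A_l\in\mathcal A$ and $A_l\to0$. **Uniform (anti-)Lyapunov functions.** Let $\Omega\subset\mathcal U$ be a connected open set. A nonnegative function $W\in C^2(\Omega)$ is a *uniform Lyapunov function* (resp. *uniform anti-Lyapunov function*) in $\Omega$ with respect to $\{\mathcal L_{A_\alpha}\}$ if, with $\rho_M=\sup_\Omega W\in(0,\infty]$, one has $W<\rho_M$ on $\Omega$, $W(x)\to\rho_M$ as $x\to\partial\Omega$ (points at infinity included, i.e. as $x$ leaves every compact subset of $\Omega$), and there are constants $\rho_m\in(0,\rho_M)$ and $\gamma>0$ such that for all $\alpha$, $\mathcal L_{A_\alpha}W\le-\gamma$ (resp. $\mathcal L_{A_\alpha}W\ge\gamma$) on $\Omega\setminus\overline{\{x\in\Omega:W(x)<\rho_m\}}$. **Attractors and repellers.** A set $K$ is *pre-compact* in $S$ if its closure in $\mathbb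 R^n$ is a compact subset of $S$. A set is positively (resp. negatively) invariant if $\varphi^t$ exists on it and maps it into itself for all $t\ge0$ (resp. $t\le0$), and invariant if $\varphi^t$ exists on it and maps it onto itself for all $t\in\mathbb R$. The *maximal attractor* (resp. *maximal repeller*) of $\varphi^t$ in a positively (resp. negatively) invariant set $\Omega$ is a compact invariant set $\mathcal J\subset\Omega$ (resp. $\mathcal R\subset\Omega$) such that for every $K$ pre-compact in $\Omega$ the forward (resp. backward) orbit of $K$ is pre-compact in $\mathcal U$ and $\omega(K)\subset\mathcal J$ (resp. $\alpha(K)\subset\mathcal R$), where $\omega(K)=\bigcap_{\tau\ge0}\overline{\bigcup_{t\ge\tau}\varphi^t(K)}$ and $\alpha(K)=\bigcap_{\tau\le0}\overline{\bigcup_{t\le\tau}\varphi^t(K)}$. **Theorem.** Let $\mathcal A=\{A_\alpha\}\subset\tilde{\mathcal A}$ be an admissible null family, $\mu$ an $\mathcal A$-limit measure, and $\Omega\subset\mathcal U$ a connected open set. a) If there exists a uniform Lyapunov function in $\Omega$ with respect to $\{\mathcal L_{A_\alpha}\}$, then $\varphi^t$ has a unique maximal attractor $\mathcal J$ in $\Omega$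 (in particular, $\Omega$ is positively invariant), and $\mu(\Omega\setminus\mathcal J)=0$. b) If $\Omega$ is pre-compact in $\mathcal U$ and there exists a uniform anti-Lyapunov function in $\Omega$ with respect to $\{\mathcal L_{A_\alpha}\}$, then $\varphi^t$ has a unique maximal repeller $\mathcal R$ in $\Omega$ (in particular, $\Omega$ is negatively invariant), and $\mu(\Omega\setminus\mathcal R)=0$. -/

import Mathlib

open Set Filter Topology MeasureTheory
open scoped ContDiff

namespace LimitMeasure

/-- The Euclidean space `ℝⁿ`. -/
abbrev Space (n : ℕ) : Type := EuclideanSpace ℝ (Fin n)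

/-! ### Partial derivatives, test functions, local Sobolev spaces -/

/-- The classical partial derivative `∂ᵢ f`. -/
noncomputable def partialD {n : ℕ} (i : Fin n) (f : Space n → ℝ) (x : Space n) : ℝ :=
  fderiv ℝ f x (EuclideanSpace.single i 1)

/-- `f ∈ C₀^∞(U)`: smooth with compact support contained in `U`. -/
def IsTestFunction {n : ℕ} (U : Set (Space n)) (f : Space n → ℝ) : Prop :=
  ContDiff ℝ ∞ f ∧ HasCompactSupport f ∧ tsupport f ⊆ U

/-- `g` is a weak partial derivative `∂ₖ f` on the open set `U`. -/
def HasWeakPartial {n : ℕ} (U : Set (Space n)) (k : Fin n) (f g : Space n → ℝ) : Prop :=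
  LocallyIntegrableOn f U ∧ LocallyIntegrableOn g U ∧
    ∀ φ : Space n → ℝ, IsTestFunction U φ →
      ∫ x in U, f x * partialD k φ x = - ∫ x in U, g x * φ x

open Classical in
/-- The weak partial derivative `∂ₖ f` on `U`, which is determined almost everywhere on `U`
(the value is `0` if there is none; it is only used for Sobolev functions). -/
noncomputable def weakPartial {n : ℕ} (U : Set (Space n)) (k : Fin n) (f : Space n → ℝ) :
    Space n → ℝ :=
  if h : ∃ g, HasWeakPartial U k f g then h.choose else 0

/-- `f ∈ W^{1,q}_loc(U)` for an exponent `q > n`: the function and its weak first derivatives are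
in `L^q(K)` for each compact `K ⊆ U`. As usual for `q > n`, `f` stands for the continuous
representative of its class, so that it can be evaluated at points and integrated against
arbitrary measures. -/
def MemSobolevLoc {n : ℕ} (U : Set (Space n)) (q : ℝ) (f : Space n → ℝ) : Prop :=
  ContinuousOn f U ∧
  (∀ K : Set (Space n), IsCompact K → K ⊆ U →
    MemLp f (ENNReal.ofReal q) (volume.restrict K)) ∧
  ∀ k : Fin n, ∃ g : Space n → ℝ, HasWeakPartial U k f g ∧
    ∀ K : Set (Space n), IsCompact K → K ⊆ U → MemLp g (ENNReal.ofReal q) (volume.restrict K)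

/-! ### Diffusion matrices and null families -/

/-- Noise coefficient matrices: `n × m` matrix fields on `U` of rank `n` at every point, with
entries in `W^{1,2p}_loc(U)`. -/
def IsNoiseMatrix {n : ℕ} (m : ℕ) (U : Set (Space n)) (p : ℝ)
    (G : Space n → Matrix (Fin n) (Fin m) ℝ) : Prop :=
  (∀ x ∈ U, (G x).rank = n) ∧ ∀ i j, MemSobolevLoc U (2 * p) (fun x => G x i j)

/-- The class of diffusion matrices: invertible matrix fields `A` on `U` with entries in
`W^{1,p}_loc(U)` of the form `A = G Gᵀ / 2` with a noise coefficient matrix `G`. -/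
def IsDiffusionMatrix {n : ℕ} (m : ℕ) (U : Set (Space n)) (p : ℝ)
    (A : Space n → Matrix (Fin n) (Fin n) ℝ) : Prop :=
  (∀ i j, MemSobolevLoc U p (fun x => A x i j)) ∧
  (∀ x ∈ U, IsUnit (A x)) ∧
  ∃ G : Space n → Matrix (Fin n) (Fin m) ℝ, IsNoiseMatrix m U p G ∧
    ∀ x ∈ U, A x = (1 / 2 : ℝ) • (G x * (G x).transpose)

/-- `A_α → 0` along the filter `l`, in the topology of `W^{1,p}`-convergence on compact subsets
of `U`. -/
def SobolevTendstoZero {n : ℕ} (U : Set (Space n)) (p : ℝ) {ι : Type*}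
    (A : ι → Space n → Matrix (Fin n) (Fin n) ℝ) (l : Filter ι) : Prop :=
  ∀ K : Set (Space n), IsCompact K → K ⊆ U → ∀ i j : Fin n,
    Tendsto (fun α => eLpNorm (fun x => A α x i j) (ENNReal.ofReal p) (volume.restrict K))
      l (𝓝 0) ∧
    ∀ k : Fin n,
      Tendsto (fun α => eLpNorm (weakPartial U k (fun x => A α x i j)) (ENNReal.ofReal p)
        (volume.restrict K)) l (𝓝 0)

/-- A null family: a net of diffusion matrices, indexed by a (nonempty) directed set, which
converges to the zero matrix. -/
def IsNullFamily {n : ℕ} (m : ℕ) (U : Set (Space n)) (p : ℝ) {ι : Type*} [Preorder ι]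
    (A : ι → Space n → Matrix (Fin n) (Fin n) ℝ) : Prop :=
  (∀ α, IsDiffusionMatrix m U p (A α)) ∧ SobolevTendstoZero U p A atTop

/-! ### Stationary measures and limit measures -/

/-- The adjoint Fokker-Planck operator `𝓛_A f = aⁱʲ ∂²ᵢⱼ f + Vⁱ ∂ᵢ f`. -/
noncomputable def adjointFP {n : ℕ} (V : Space n → Space n)
    (A : Space n → Matrix (Fin n) (Fin n) ℝ) (f : Space n → ℝ) (x : Space n) : ℝ :=
  ∑ i, ∑ j, A x i j * partialD i (partialD j f) x + ∑ i, V x i * partialD i f x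

/-- `μ` is a stationary measure corresponding to `𝓛_A`: a Borel probability measure on `U` with
`∫_U 𝓛_A f dμ = 0` for all `f ∈ C₀^∞(U)`. -/
def IsStationaryMeasure {n : ℕ} (U : Set (Space n)) (V : Space n → Space n)
    (A : Space n → Matrix (Fin n) (Fin n) ℝ) (μ : ProbabilityMeasure U) : Prop :=
  ∀ f : Space n → ℝ, IsTestFunction U f →
    ∫ x : U, adjointFP V A f (x : Space n) ∂(μ : Measure U) = 0

/-- A family is admissible if each of its members has a stationary measure. -/
def IsAdmissible {n : ℕ} (U : Set (Space n)) (V : Space n → Space n) {ι : Type*}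
    (A : ι → Space n → Matrix (Fin n) (Fin n) ℝ) : Prop :=
  ∀ α, ∃ μ : ProbabilityMeasure U, IsStationaryMeasure U V (A α) μ

/-- `μ` is a limit measure of the family `A`: the limit, in the topology of weak convergence of
probability measures on `U`, of a sequence of stationary measures corresponding to members
`A_{α_l}` of the family with `A_{α_l} → 0`. -/
def IsLimitMeasure {n : ℕ} (U : Set (Space n)) (p : ℝ) (V : Space n → Space n) {ι : Type*}
    (A : ι → Space n → Matrix (Fin n) (Fin n) ℝ) (μ : ProbabilityMeasure U) : Prop :=
  ∃ (α : ℕ → ι) (ν : ℕ → ProbabilityMeasure U),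
    SobolevTendstoZero U p (fun l => A (α l)) atTop ∧
    (∀ l, IsStationaryMeasure U V (A (α l)) (ν l)) ∧
    Tendsto ν atTop (𝓝 μ)

/-! ### Uniform Lyapunov and anti-Lyapunov functions -/

/-- The essential upper bound `ρ_M = sup_Ω W ∈ (-∞, ∞]`. -/
noncomputable def essUpper {n : ℕ} (Ω : Set (Space n)) (W : Space n → ℝ) : EReal :=
  ⨆ x : Ω, ((W x : ℝ) : EReal)

/-- A `C²` compact function on the open set `Ω`: nonnegative, everywhere smaller than its
supremum `ρ_M`, with `W(x) → ρ_M` as `x → ∂Ω`. Here `∂Ω` is taken in the compactification of `ℝⁿ`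
by a sphere at infinity; as the closure of `Ω` in it is compact, `x → ∂Ω` means that `x ∈ Ω`
eventually leaves every compact subset of `Ω`, that is, convergence along `cocompact Ω`. -/
def IsCompactFunction {n : ℕ} (Ω : Set (Space n)) (W : Space n → ℝ) : Prop :=
  ContDiffOn ℝ 2 W Ω ∧ (∀ x ∈ Ω, 0 ≤ W x) ∧
  (∀ x ∈ Ω, (W x : EReal) < essUpper Ω W) ∧
  Tendsto (fun x : Ω => ((W x : ℝ) : EReal)) (cocompact Ω) (𝓝 (essUpper Ω W))

/-- The essential domain `Ω ∖ closure {x ∈ Ω | W x < ρ}`. -/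
def essDomain {n : ℕ} (Ω : Set (Space n)) (W : Space n → ℝ) (ρ : ℝ) : Set (Space n) :=
  Ω \ closure {x | x ∈ Ω ∧ W x < ρ}

/-- `W` is a uniform Lyapunov function in `Ω` for the operators `𝓛_{A_α}`: the essential lower
bound `ρ_m ∈ (0, ρ_M)` and the Lyapunov constant `γ > 0` do not depend on `α`. -/
def IsUniformLyapunov {n : ℕ} (Ω : Set (Space n)) (V : Space n → Space n) {ι : Type*}
    (A : ι → Space n → Matrix (Fin n) (Fin n) ℝ) (W : Space n → ℝ) : Prop :=
  IsCompactFunction Ω W ∧ ∃ ρm γ : ℝ, 0 < ρm ∧ (ρm : EReal) < essUpper Ω W ∧ 0 < γ ∧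
    ∀ α, ∀ x ∈ essDomain Ω W ρm, adjointFP V (A α) W x ≤ -γ

/-- `W` is a uniform anti-Lyapunov function in `Ω` for the operators `𝓛_{A_α}`. -/
def IsUniformAntiLyapunov {n : ℕ} (Ω : Set (Space n)) (V : Space n → Space n) {ι : Type*}
    (A : ι → Space n → Matrix (Fin n) (Fin n) ℝ) (W : Space n → ℝ) : Prop :=
  IsCompactFunction Ω W ∧ ∃ ρm γ : ℝ, 0 < ρm ∧ (ρm : EReal) < essUpper Ω W ∧ 0 < γ ∧
    ∀ α, ∀ x ∈ essDomain Ω W ρm, γ ≤ adjointFP V (A α) W x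

/-! ### The local flow, invariant sets, maximal attractors and repellers -/

/-- `γ` solves `ẋ = V(x)` in `U` on the open interval `(a, b) ∋ 0`, with `γ 0 = ξ`. -/
def IsSolution {n : ℕ} (U : Set (Space n)) (V : Space n → Space n) (ξ : Space n) (a b : ℝ)
    (γ : ℝ → Space n) : Prop :=
  a < 0 ∧ 0 < b ∧ γ 0 = ξ ∧ ∀ t ∈ Ioo a b, γ t ∈ U ∧ HasDerivAt γ (V (γ t)) t

/-- The maximal interval of existence in `U` of the solution through `ξ`. -/
def existenceInterval {n : ℕ} (U : Set (Space n)) (V : Space n → Space n) (ξ : Space n) : Set ℝ :=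
  {t | ∃ a b γ, t ∈ Ioo a b ∧ IsSolution U V ξ a b γ}

open Classical in
/-- The local flow `φᵗ(ξ)` of `ẋ = V(x)` on `U`: the value at time `t` of the solution through
`ξ` (which is unique for `V ∈ C¹`). Outside the maximal interval of existence the value `ξ` is a
placeholder; the notions below never make use of it. -/
noncomputable def localFlow {n : ℕ} (U : Set (Space n)) (V : Space n → Space n)
    (t : ℝ) (ξ : Space n) : Space n :=
  if h : ∃ γ : ℝ → Space n, ∃ a b, t ∈ Ioo a b ∧ IsSolution U V ξ a b γ then h.choose t else ξ

def IsInvariantSet {n : ℕ} (U : Set (Space n)) (V : Space n → Space n) (B : Set (Space n)) :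
    Prop :=
  B ⊆ U ∧ (∀ ξ ∈ B, existenceInterval U V ξ = univ) ∧ ∀ t : ℝ, localFlow U V t '' B = B

def IsPosInvariantSet {n : ℕ} (U : Set (Space n)) (V : Space n → Space n) (B : Set (Space n)) :
    Prop :=
  B ⊆ U ∧ (∀ ξ ∈ B, Ici 0 ⊆ existenceInterval U V ξ) ∧
    ∀ t : ℝ, 0 ≤ t → localFlow U V t '' B ⊆ B

def IsNegInvariantSet {n : ℕ} (U : Set (Space n)) (V : Space n → Space n) (B : Set (Space n)) :
    Prop :=
  B ⊆ U ∧ (∀ ξ ∈ B, Iic 0 ⊆ existenceInterval U V ξ) ∧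
    ∀ t : ℝ, t ≤ 0 → localFlow U V t '' B ⊆ B

/-- `K` is pre-compact in `S`: its closure in `ℝⁿ` is a compact subset of `S`. -/
def IsPrecompactIn {n : ℕ} (S K : Set (Space n)) : Prop :=
  IsCompact (closure K) ∧ closure K ⊆ S

/-- `J` is the maximal attractor in the positively invariant set `Ω`: a compact invariant set in
`Ω` which attracts each pre-compact subset `K` of `Ω`, that is, the forward orbit of `K` is
pre-compact in `U` (so that its `ω`-limit set is defined) and `ω(K) ⊆ J`. -/
def IsMaximalAttractor {n : ℕ} (U : Set (Space n)) (V : Space n → Space n)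
    (Ω J : Set (Space n)) : Prop :=
  IsPosInvariantSet U V Ω ∧ J ⊆ Ω ∧ IsCompact J ∧ IsInvariantSet U V J ∧
  ∀ K : Set (Space n), IsPrecompactIn Ω K →
    IsPrecompactIn U (⋃ t ∈ Ici (0 : ℝ), localFlow U V t '' K) ∧
    omegaLimit atTop (localFlow U V) K ⊆ J

/-- `R` is the maximal repeller in the negatively invariant set `Ω`: a compact invariant set in
`Ω` which repels each pre-compact subset `K` of `Ω`, that is, the backward orbit of `K` is
pre-compact in `U` (so that its `α`-limit set is defined) and `α(K) ⊆ R`. -/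
def IsMaximalRepeller {n : ℕ} (U : Set (Space n)) (V : Space n → Space n)
    (Ω R : Set (Space n)) : Prop :=
  IsNegInvariantSet U V Ω ∧ R ⊆ Ω ∧ IsCompact R ∧ IsInvariantSet U V R ∧
  ∀ K : Set (Space n), IsPrecompactIn Ω K →
    IsPrecompactIn U (⋃ t ∈ Iic (0 : ℝ), localFlow U V t '' K) ∧
    omegaLimit atBot (localFlow U V) K ⊆ R

end LimitMeasure

namespace LimitMeasure

/-! ### Morrey's inequality -/

section Morrey

variable {n : ℕ}

/-! As the diffusion vanishes, both sides of the problem become statements about the drift alone.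
Since `p > n`, Morrey's inequality turns `W^{1,p}` convergence on compacts into uniform convergence
there (`SobolevTendstoZero.eventually_abs_lt`). Hence the stationary equations pass to the limit: `∫
DF(V) dμ = 0` for every test function `F` (`IsLimitMeasure.integral_fderiv_eq_zero`). The uniform
Lyapunov inequality likewise passes to the limit pointwise: `DW(V) ≤ -γ` wherever `W > ρ_m`
(`tendsto_adjointFP`).

From this inequality the dynamics follow. Sublevel sets of `W` are compact and forward invariant,
and orbits reach `{W ≤ c}`, for `ρ_m < c < ρ_M`, in a time bounded on compact sets. The intersection
of the images `φᵗ({W ≤ c})`, `t ≥ 0`, is the maximal attractor (`isMaximalAttractor_attractorSet`).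

The measure is handled in two steps. Testing the limit equation with a decreasing cutoff of `W`
gives an integrand of one sign, so `μ` does not charge `{W > ρ_m}` in `Ω`
(`measure_lyapunov_eq_zero`). The restriction of `μ` to `Ω` then lives on the compact set `B = {W ≤
c}`, and it is invariant under the flow of a truncated field (`integral_comp_flow_eq`). Thus `φᵗ(B)
⊆ B` carries at least the mass of `B`; each difference `B \ φᵗ(B)` is null, and countably many of
them exhaust `B` minus the attractor (`measure_compl_attractorSet`).

The repeller statement is the attractor statement for `-V`. The reversal is made only after the
limit: the second-order term has no sign symmetry, but the limit inequality and the limit equation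
do. -/

theorem fderiv_apply_eq_sum_partialD (f : Space n → ℝ) (x v : Space n) :
    fderiv ℝ f x v = ∑ i, v i * partialD i f x := by
  conv_lhs => rw [← (EuclideanSpace.basisFun (Fin n) ℝ).sum_repr v]
  simp [partialD]

/-- A fixed smooth bump function supported in the closed unit ball. -/
noncomputable def unitBump (n : ℕ) : ContDiffBump (0 : Space n) :=
  ⟨1 / 2, 1, by norm_num, by norm_num⟩

theorem unitBump_eq_zero {z : Space n} (hz : 1 ≤ ‖z‖) : unitBump n z = 0 :=
  (unitBump n).zero_of_le_dist (by simpa [unitBump] using hz)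

theorem contDiff_unitBump : ContDiff ℝ ∞ (unitBump n) := (unitBump n).contDiff

theorem integral_unitBump_pos : 0 < ∫ z, unitBump n z := (unitBump n).integral_pos

/-- The unit bump function rescaled to the ball of radius `e` around `x`. -/
noncomputable def bumpKernel (x : Space n) (e : ℝ) (y : Space n) : ℝ :=
  e⁻¹ ^ n * unitBump n (e⁻¹ • (y - x))

/-- The divergence of the vector field `z ↦ φ(z) z`, where `φ` is the unit bump function. -/
noncomputable def bumpDiv (z : Space n) : ℝ := n * unitBump n z + fderiv ℝ (unitBump n) z z

/-- The components of the rescaled vector field `z ↦ φ(z) z`. -/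
noncomputable def bumpField (x : Space n) (e : ℝ) (i : Fin n) (y : Space n) : ℝ :=
  e⁻¹ ^ n * ((e⁻¹ • (y - x)) i * unitBump n (e⁻¹ • (y - x)))

theorem scaled_norm_lt_one {x y : Space n} {e : ℝ} (he : 0 < e) (hy : y ∉ Metric.closedBall x e) :
    1 < ‖e⁻¹ • (y - x)‖ := by
  rw [norm_smul, Real.norm_of_nonneg (inv_nonneg.2 he.le), ← div_eq_inv_mul, one_lt_div he,
    ← dist_eq_norm]
  simpa using hy

theorem scaled_norm_le_one {x y : Space n} {e : ℝ} (he : 0 < e) (hy : y ∈ Metric.closedBall x e) :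
    ‖e⁻¹ • (y - x)‖ ≤ 1 := by
  rw [norm_smul, Real.norm_of_nonneg (inv_nonneg.2 he.le), ← div_eq_inv_mul, div_le_one he,
    ← dist_eq_norm]
  simpa using hy

theorem fderiv_unitBump_eq_zero {z : Space n} (hz : 1 < ‖z‖) : fderiv ℝ (unitBump n) z = 0 := by
  have : (unitBump n : Space n → ℝ) =ᶠ[𝓝 z] fun _ => 0 := by
    filter_upwards [(isOpen_lt continuous_const continuous_norm).mem_nhds hz] with y hy
    exact unitBump_eq_zero (le_of_lt hy)
  rw [this.fderiv_eq]; simp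

theorem continuous_bumpDiv : Continuous (bumpDiv (n := n)) := by
  have h := (contDiff_unitBump (n := n)).continuous
  have h' := (contDiff_unitBump (n := n)).continuous_fderiv (by norm_num)
  unfold bumpDiv
  exact (continuous_const.mul h).add (h'.clm_apply continuous_id)

theorem bumpDiv_eq_zero {z : Space n} (hz : 1 < ‖z‖) : bumpDiv z = 0 := by
  simp [bumpDiv, unitBump_eq_zero hz.le, fderiv_unitBump_eq_zero hz]

theorem exists_bumpDiv_bound (n : ℕ) : ∃ S : ℝ, 0 ≤ S ∧ ∀ z : Space n, |bumpDiv z| ≤ S := by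
  have hc : HasCompactSupport (bumpDiv (n := n)) :=
    HasCompactSupport.intro (isCompact_closedBall (0 : Space n) 1) fun z hz =>
      bumpDiv_eq_zero (by simpa using hz)
  obtain ⟨S, hS⟩ := hc.exists_bound_of_continuous continuous_bumpDiv
  exact ⟨S, (abs_nonneg _).trans (hS 0), hS⟩

/-- Changing the scale of the kernel moves mass radially, so the scale derivative is minus the
divergence of a rescaled copy of `z ↦ φ(z) z`. This lets a weak gradient control how local averages
depend on the scale. -/
theorem hasDerivAt_bumpKernel (x y : Space n) {e : ℝ} (he : e ≠ 0) :
    HasDerivAt (fun e => bumpKernel x e y) (-(e⁻¹ ^ (n + 1) * bumpDiv (e⁻¹ • (y - x)))) e := by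
  have hw := hasDerivAt_inv he
  have h1 : HasDerivAt (fun e : ℝ => e⁻¹ ^ n) (-(n * e⁻¹ ^ (n + 1))) e := by
    refine (hw.pow n).congr_deriv ?_
    -- The power rule produces the truncated exponent `n - 1`, so dimension zero is separated.
    rcases n with _ | k
    · simp
    · simp only [Nat.add_sub_cancel]
      have : (e ^ 2)⁻¹ = e⁻¹ ^ 2 := by rw [inv_pow]
      rw [this]; ring
  have h2 : HasDerivAt (fun e : ℝ => unitBump n (e⁻¹ • (y - x)))
      (fderiv ℝ (unitBump n) (e⁻¹ • (y - x)) ((-(e ^ 2)⁻¹) • (y - x))) e :=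
    HasFDerivAt.comp_hasDerivAt (l := unitBump n) (f := fun e : ℝ => e⁻¹ • (y - x)) e
      ((contDiff_unitBump (n := n)).differentiable (by norm_num) _).hasFDerivAt
      (hw.smul_const (y - x))
  refine (h1.mul h2).congr_deriv ?_
  simp only [bumpDiv, map_smul, smul_eq_mul, ← inv_pow]
  ring

theorem contDiff_bumpField (x : Space n) (e : ℝ) (i : Fin n) : ContDiff ℝ ∞ (bumpField x e i) := by
  have h1 : ContDiff ℝ ∞ fun y : Space n => e⁻¹ • (y - x) := by fun_prop
  have h2 : ContDiff ℝ ∞ fun y : Space n => (e⁻¹ • (y - x)) i := by fun_prop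
  exact contDiff_const.mul (h2.mul (contDiff_unitBump.comp h1))

theorem bumpField_eq_zero {x y : Space n} {e : ℝ} (he : 0 < e) (i : Fin n)
    (hy : y ∉ Metric.closedBall x e) : bumpField x e i y = 0 := by
  simp [bumpField, unitBump_eq_zero (scaled_norm_lt_one he hy).le]

theorem isTestFunction_bumpField {U : Set (Space n)} {x : Space n} {e : ℝ} (he : 0 < e)
    (hU : Metric.closedBall x e ⊆ U) (i : Fin n) : IsTestFunction U (bumpField x e i) := by
  have hts : tsupport (bumpField x e i) ⊆ Metric.closedBall x e :=
    closure_minimal (fun y hy => by by_contra h; exact hy (bumpField_eq_zero he i h))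
      Metric.isClosed_closedBall
  exact ⟨contDiff_bumpField x e i,
    (isCompact_closedBall x e).of_isClosed_subset (isClosed_tsupport _) hts, hts.trans hU⟩

theorem abs_bumpField_le {x y : Space n} {e : ℝ} (he : 0 < e) (i : Fin n) :
    |bumpField x e i y| ≤ e⁻¹ ^ n := by
  have he' : 0 ≤ e⁻¹ ^ n := by positivity
  by_cases hy : y ∈ Metric.closedBall x e
  · rw [bumpField, abs_mul, abs_of_nonneg he', abs_mul, abs_of_nonneg (unitBump n).nonneg]
    refine mul_le_of_le_one_right he' (mul_le_one₀ ?_ (unitBump n).nonneg (unitBump n).le_one)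
    exact (PiLp.norm_apply_le (e⁻¹ • (y - x)) i).trans
      (scaled_norm_le_one he hy)
  · rw [bumpField_eq_zero he i hy, abs_zero]; exact he'

/-- The right side is the negative of the scale derivative in `hasDerivAt_bumpKernel`. The
normalizations are chosen so that the two match exactly. -/
theorem sum_partialD_bumpField (x y : Space n) (e : ℝ) :
    ∑ i, partialD i (bumpField x e i) y = e⁻¹ ^ (n + 1) * bumpDiv (e⁻¹ • (y - x)) := by
  set z := e⁻¹ • (y - x) with hz
  have h1 : HasFDerivAt (fun y : Space n => e⁻¹ • (y - x)) (e⁻¹ • ContinuousLinearMap.id ℝ _) y :=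
    ((hasFDerivAt_id y).sub_const x).const_smul e⁻¹
  have h2 := ((contDiff_unitBump (n := n)).differentiable (by norm_num) z).hasFDerivAt.comp y h1
  have h3 : ∀ i, partialD i (bumpField x e i) y = e⁻¹ ^ (n + 1) *
      (unitBump n z + z i * partialD i (unitBump n) z) := by
    intro i
    have h4 : HasFDerivAt (fun y : Space n => (e⁻¹ • (y - x)) i)
        ((EuclideanSpace.proj i : Space n →L[ℝ] ℝ).comp (e⁻¹ • ContinuousLinearMap.id ℝ _)) y :=
      (EuclideanSpace.proj i : Space n →L[ℝ] ℝ).hasFDerivAt.comp y h1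
    have h5 := (h4.mul h2).const_mul (e⁻¹ ^ n)
    have h6 : fderiv ℝ (bumpField x e i) y = _ := h5.fderiv
    rw [partialD, h6, partialD]
    simp [← hz, pow_succ]
    ring
  have h7 : fderiv ℝ (unitBump n) z z = ∑ i, z i * partialD i (unitBump n) z := by
    conv_lhs => rw [fderiv_apply_eq_sum_partialD]
  simp only [h3, ← Finset.mul_sum, Finset.sum_add_distrib, bumpDiv, h7]
  simp

theorem bumpKernel_eq_zero {x y : Space n} {e : ℝ} (he : 0 < e)
    (hy : y ∉ Metric.closedBall x e) : bumpKernel x e y = 0 := by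
  simp [bumpKernel, unitBump_eq_zero (scaled_norm_lt_one he hy).le]

theorem bumpKernel_nonneg {x y : Space n} {e : ℝ} (he : 0 < e) : 0 ≤ bumpKernel x e y :=
  mul_nonneg (by positivity) (unitBump n).nonneg

theorem bumpKernel_le {x y : Space n} {e : ℝ} (he : 0 < e) : bumpKernel x e y ≤ e⁻¹ ^ n :=
  mul_le_of_le_one_right (by positivity) (unitBump n).le_one

theorem continuous_bumpKernel (x : Space n) (e : ℝ) : Continuous (bumpKernel x e) :=
  continuous_const.mul ((contDiff_unitBump (n := n)).continuous.comp (by fun_prop))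

theorem integral_bumpKernel (x : Space n) {e : ℝ} (he : 0 < e) :
    ∫ y, bumpKernel x e y = ∫ z, unitBump n z := by
  simp only [bumpKernel]
  rw [integral_const_mul, integral_sub_right_eq_self (fun y => unitBump n (e⁻¹ • y)) x,
    Measure.integral_comp_inv_smul_of_nonneg _ _ he.le]
  simp [he.ne']

/-- A locally integrable function times a continuous function vanishing off a ball is integrable. -/
theorem integrableOn_mul_of_closedBall {U : Set (Space n)} {x : Space n} {R : ℝ}
    (hR : Metric.closedBall x R ⊆ U) {f h : Space n → ℝ} (hf : LocallyIntegrableOn f U)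
    (hU : MeasurableSet U) (hh : Continuous h) (h0 : ∀ y ∉ Metric.closedBall x R, h y = 0) :
    IntegrableOn (fun y => f y * h y) U := by
  have h1 : IntegrableOn f (Metric.closedBall x R) :=
    hf.integrableOn_compact_subset hR (isCompact_closedBall x R)
  exact (h1.mul_continuousOn hh.continuousOn (isCompact_closedBall x R)).of_forall_sdiff_eq_zero hU
    fun y hy => by simp [h0 y hy.2]

/-- Hölder's inequality on a ball. -/
theorem integral_abs_closedBall_le {K : Set (Space n)} {p δ : ℝ} (hp : 1 ≤ p) (hδ : 0 ≤ δ)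
    {x : Space n} {e : ℝ} (he : 0 < e) (hK : Metric.closedBall x e ⊆ K) {g : Space n → ℝ}
    (hg : IntegrableOn g (Metric.closedBall x e))
    (hgδ : eLpNorm g (ENNReal.ofReal p) (volume.restrict K) ≤ ENNReal.ofReal δ) :
    ∫ y in Metric.closedBall x e, |g y| ≤
      δ * (volume.real (Metric.closedBall (0 : Space n) 1)) ^ (1 - 1 / p) *
        (e ^ n) ^ (1 - 1 / p) := by
  have hp' : (0 : ℝ) ≤ 1 - 1 / p := sub_nonneg.2 ((div_le_one (by linarith)).2 hp)
  have h1 := eLpNorm_le_eLpNorm_mul_rpow_measure_univ (p := 1) (q := ENNReal.ofReal p)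
    (by simpa using hp) hg.aestronglyMeasurable
  have h2 : eLpNorm g (ENNReal.ofReal p) (volume.restrict (Metric.closedBall x e)) ≤
      ENNReal.ofReal δ :=
    (eLpNorm_mono_measure g (Measure.restrict_mono hK le_rfl)).trans hgδ
  have hvol : volume (Metric.closedBall x e) =
      ENNReal.ofReal (e ^ n * volume.real (Metric.closedBall (0 : Space n) 1)) := by
    rw [ENNReal.ofReal_mul (by positivity), Measure.addHaar_closedBall' _ _ he.le,
      finrank_euclideanSpace_fin, measureReal_def,
      ENNReal.ofReal_toReal measure_closedBall_lt_top.ne]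
  have h3 : ENNReal.ofReal (∫ y in Metric.closedBall x e, |g y|) =
      eLpNorm g 1 (volume.restrict (Metric.closedBall x e)) := by
    rw [eLpNorm_one_eq_lintegral_enorm]
    exact ofReal_integral_norm_eq_lintegral_enorm hg
  rw [← ENNReal.ofReal_le_ofReal_iff (by positivity), h3]
  refine h1.trans ?_
  rw [Measure.restrict_apply_univ, hvol, ENNReal.toReal_one, ENNReal.toReal_ofReal (by linarith),
    div_one, ENNReal.ofReal_rpow_of_nonneg (by positivity) hp', mul_assoc,
    ENNReal.ofReal_mul hδ, mul_comm (_ ^ _ : ℝ) ((e ^ n) ^ _),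
    ← Real.mul_rpow (by positivity) (by positivity)]
  gcongr

/-- Differentiation under the integral sign. Scales in `(e / 2, R)` stay away from the singularity
at zero and keep all supports in one fixed ball, which gives an integrable majorant. -/
theorem hasDerivAt_integral_bumpKernel {U : Set (Space n)} (hU : IsOpen U) {x : Space n} {R : ℝ}
    (hR : Metric.closedBall x R ⊆ U) {f : Space n → ℝ} (hf : LocallyIntegrableOn f U) {e : ℝ}
    (he : 0 < e) (heR : e < R) :
    HasDerivAt (fun e => ∫ y in U, f y * bumpKernel x e y)
      (∫ y in U, f y * -(e⁻¹ ^ (n + 1) * bumpDiv (e⁻¹ • (y - x)))) e := by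
  obtain ⟨S, hS0, hS⟩ := exists_bumpDiv_bound n
  have hfm : AEStronglyMeasurable f (volume.restrict U) := hf.aestronglyMeasurable
  have hdc : ∀ e : ℝ, Continuous fun y : Space n =>
      -(e⁻¹ ^ (n + 1) * bumpDiv (e⁻¹ • (y - x))) := fun e =>
    (continuous_const.mul (continuous_bumpDiv.comp (by fun_prop))).neg
  have hball : ∀ {e : ℝ}, e < R → Metric.closedBall x e ⊆ U := fun h =>
    (Metric.closedBall_subset_closedBall h.le).trans hR
  refine (hasDerivAt_integral_of_dominated_loc_of_deriv_le (s := Ioo (e / 2) R)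
    (F := fun e y => f y * bumpKernel x e y)
    (F' := fun e y => f y * -(e⁻¹ ^ (n + 1) * bumpDiv (e⁻¹ • (y - x))))
    (bound := (Metric.closedBall x R).indicator fun y => |f y| * ((e / 2)⁻¹ ^ (n + 1) * S))
    (Ioo_mem_nhds (by linarith) heR) ?_ ?_ ?_ ?_ ?_ ?_).2
  · exact Eventually.of_forall fun e =>
      hfm.mul (continuous_bumpKernel x e).aestronglyMeasurable
  · exact integrableOn_mul_of_closedBall (hball heR) hf hU.measurableSet
      (continuous_bumpKernel x e) fun y hy => bumpKernel_eq_zero he hy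
  · exact hfm.mul (hdc e).aestronglyMeasurable
  · refine Eventually.of_forall fun y e' he' => ?_
    have he'0 : 0 < e' := by linarith [he'.1]
    by_cases hy : y ∈ Metric.closedBall x R
    · rw [indicator_of_mem hy, norm_mul, norm_neg, Real.norm_eq_abs, Real.norm_eq_abs, abs_mul,
        abs_of_nonneg (by positivity : 0 ≤ e'⁻¹ ^ (n + 1))]
      have h1 : e'⁻¹ ≤ (e / 2)⁻¹ := inv_anti₀ (by linarith) he'.1.le
      have h2 : 0 ≤ e'⁻¹ := by positivity
      gcongr
      exact hS _
    · have hy' : y ∉ Metric.closedBall x e' := fun h =>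
        hy (Metric.closedBall_subset_closedBall he'.2.le h)
      rw [indicator_of_notMem hy, bumpDiv_eq_zero (scaled_norm_lt_one he'0 hy')]
      simp
  · rw [integrable_indicator_iff Metric.isClosed_closedBall.measurableSet, IntegrableOn,
      Measure.restrict_restrict Metric.isClosed_closedBall.measurableSet,
      inter_eq_self_of_subset_left hR]
    exact (hf.integrableOn_compact_subset hR (isCompact_closedBall x R)).abs.mul_const _
  · exact Eventually.of_forall fun y e' he' =>
      (hasDerivAt_bumpKernel x y (by linarith [he'.1])).const_mul (f y)

theorem tendsto_integral_bumpKernel {U : Set (Space n)} (hU : IsOpen U) {f : Space n → ℝ}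
    (hf : ContinuousOn f U) {x : Space n} (hx : x ∈ U) :
    Tendsto (fun e => ∫ y in U, f y * bumpKernel x e y) (𝓝[>] 0)
      (𝓝 ((∫ z, unitBump n z) * f x)) := by
  set c := ∫ z, unitBump n z
  have hc : 0 < c := integral_unitBump_pos
  rw [Metric.tendsto_nhdsWithin_nhds]
  intro η hη
  obtain ⟨R, hR, hRU⟩ := Metric.nhds_basis_closedBall.mem_iff.1 (hU.mem_nhds hx)
  have hcont := (hf.continuousAt (hU.mem_nhds hx))
  obtain ⟨d, hd, hd'⟩ := Metric.continuousAt_iff.1 hcont (η / (2 * c)) (by positivity)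
  refine ⟨min R d, lt_min hR hd, fun e he hed => ?_⟩
  have he0 : 0 < e := he
  rw [Real.dist_eq, sub_zero, abs_of_pos he0, lt_min_iff] at hed
  have hB : Metric.closedBall x e ⊆ U := (Metric.closedBall_subset_closedBall hed.1.le).trans hRU
  have hi1 := integrableOn_mul_of_closedBall hB (hf.locallyIntegrableOn hU.measurableSet)
    hU.measurableSet (continuous_bumpKernel x e) fun y hy => bumpKernel_eq_zero he0 hy
  have hi2 := integrableOn_mul_of_closedBall (f := fun _ => f x) hB
    (continuousOn_const.locallyIntegrableOn hU.measurableSet)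
    hU.measurableSet (continuous_bumpKernel x e) fun y hy => bumpKernel_eq_zero he0 hy
  have hk : ∫ y in U, bumpKernel x e y = c := by
    rw [setIntegral_eq_integral_of_forall_compl_eq_zero
      (fun y hy => bumpKernel_eq_zero he0 fun h => hy (hB h)), integral_bumpKernel x he0]
  have hki : IntegrableOn (bumpKernel x e) U := by
    have := integrableOn_mul_of_closedBall (f := fun _ => (1 : ℝ)) hB
      (continuousOn_const.locallyIntegrableOn hU.measurableSet)
      hU.measurableSet (continuous_bumpKernel x e) fun y hy => bumpKernel_eq_zero he0 hy
    simpa using this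
  have h1 : (∫ y in U, f y * bumpKernel x e y) - c * f x =
      ∫ y in U, (f y - f x) * bumpKernel x e y := by
    simp only [sub_mul]
    rw [integral_sub hi1 hi2, integral_const_mul, hk, mul_comm c]
  rw [Real.dist_eq, h1]
  calc |∫ y in U, (f y - f x) * bumpKernel x e y|
      ≤ ∫ y in U, η / (2 * c) * bumpKernel x e y := by
        rw [← Real.norm_eq_abs]
        refine norm_integral_le_of_norm_le (hki.const_mul _) (Eventually.of_forall fun y => ?_)
        rw [norm_mul, Real.norm_of_nonneg (bumpKernel_nonneg he0)]
        by_cases hy : y ∈ Metric.closedBall x e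
        · refine mul_le_mul_of_nonneg_right ?_ (bumpKernel_nonneg he0)
          exact (hd' (lt_of_le_of_lt (Metric.mem_closedBall.1 hy) hed.2)).le
        · simp [bumpKernel_eq_zero he0 hy]
    _ = η / 2 := by rw [integral_const_mul, hk]; field_simp
    _ < η := by linarith

theorem abs_integral_mul_le_of_closedBall {U : Set (Space n)} (hU : MeasurableSet U) {x : Space n}
    {e b : ℝ} (hB : Metric.closedBall x e ⊆ U) {g k : Space n → ℝ}
    (hg : LocallyIntegrableOn g U) (hk : ∀ y, |k y| ≤ b)
    (hk0 : ∀ y ∉ Metric.closedBall x e, k y = 0) :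
    |∫ y in U, g y * k y| ≤ b * ∫ y in Metric.closedBall x e, |g y| := by
  rw [← integral_const_mul, ← Real.norm_eq_abs,
    setIntegral_eq_of_subset_of_forall_sdiff_eq_zero hU hB fun y hy => by simp [hk0 y hy.2]]
  refine norm_integral_le_of_norm_le
    ((hg.integrableOn_compact_subset hB (isCompact_closedBall x e)).abs.const_mul b)
    (Eventually.of_forall fun y => ?_)
  rw [norm_mul, mul_comm, Real.norm_eq_abs, Real.norm_eq_abs]
  exact mul_le_mul_of_nonneg_right (hk y) (abs_nonneg _)

/-- **Morrey's inequality**, in the form of a pointwise bound by the `W^{1,p}` norm on a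
neighbourhood. -/
theorem exists_morrey_bound (hn : 0 < n) {p : ℝ} (hp : (n : ℝ) < p) {r : ℝ} (hr : 0 < r) :
    ∃ C : ℝ, 0 ≤ C ∧ ∀ (U K : Set (Space n)), IsOpen U → K ⊆ U → ∀ (f : Space n → ℝ)
      (g : Fin n → Space n → ℝ), ContinuousOn f U → (∀ i, HasWeakPartial U i f (g i)) →
      ∀ δ : ℝ, 0 ≤ δ →
      eLpNorm f (ENNReal.ofReal p) (volume.restrict K) ≤ ENNReal.ofReal δ →
      (∀ i, eLpNorm (g i) (ENNReal.ofReal p) (volume.restrict K) ≤ ENNReal.ofReal δ) →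
      ∀ x, Metric.closedBall x (2 * r) ⊆ K → |f x| ≤ C * δ := by
  have hn1 : (1 : ℝ) ≤ n := by exact_mod_cast hn
  have hp1 : 1 ≤ p := by linarith
  have hp0 : 0 < p := by linarith
  set c := ∫ z, unitBump n z with hcdef
  have hc : 0 < c := integral_unitBump_pos
  set a : ℝ := (volume.real (Metric.closedBall (0 : Space n) 1)) ^ (1 - 1 / p) with ha
  have ha0 : 0 ≤ a := by positivity
  set s : ℝ := 1 - n / p with hs
  have hs0 : 0 < s := by
    rw [hs, sub_pos, div_lt_one hp0]; exact hp
  have hpow : ∀ e : ℝ, 0 < e → e⁻¹ ^ n * (e ^ n) ^ (1 - 1 / p) = e ^ (s - 1) := by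
    intro e he
    rw [← Real.rpow_natCast e n, ← Real.rpow_mul he.le, inv_pow, ← Real.rpow_natCast e n,
      ← Real.rpow_neg he.le, ← Real.rpow_add he]
    congr 1
    rw [hs]; ring
  -- `C₁` is the Hölder bound for the average at scale `r`. `C₂` is the integral of `n a e^(s - 1)`
  -- over `(0, r)`, finite because `s = 1 - n/p > 0`.
  set C₁ : ℝ := a * r ^ (s - 1)
  set C₂ : ℝ := n * a * (s⁻¹ * r ^ s)
  refine ⟨(C₁ + C₂) / c, by positivity, fun U K hU hKU f g hf hg δ hδ hfδ hgδ x hxK => ?_⟩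
  have hxU : Metric.closedBall x (2 * r) ⊆ U := hxK.trans hKU
  have hfl : LocallyIntegrableOn f U := hf.locallyIntegrableOn hU.measurableSet
  have hB : ∀ e : ℝ, e < 2 * r → Metric.closedBall x e ⊆ Metric.closedBall x (2 * r) := fun e he =>
    Metric.closedBall_subset_closedBall he.le
  set F : ℝ → ℝ := fun e => ∫ y in U, f y * bumpKernel x e y with hF
  set F' : ℝ → ℝ := fun e => ∫ y in U, f y * -(e⁻¹ ^ (n + 1) * bumpDiv (e⁻¹ • (y - x)))
  have hderiv : ∀ e, 0 < e → e < 2 * r → HasDerivAt F (F' e) e := fun e he her =>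
    hasDerivAt_integral_bumpKernel hU hxU hfl he her
  have hF' : ∀ e, 0 < e → e < 2 * r → |F' e| ≤ n * a * δ * e ^ (s - 1) := by
    intro e he her
    have hBe := (hB e her).trans hxU
    -- The scale derivative is a divergence, so the weak derivative formula moves it onto `f`. The
    -- kernel left over is bounded by `e⁻¹ ^ n`, and Hölder gives the rate `e^(s - 1)`.
    have h1 : F' e = ∑ i, ∫ y in U, g i y * bumpField x e i y := by
      have h2 : ∀ i, ∫ y in U, g i y * bumpField x e i y =
          -∫ y in U, f y * partialD i (bumpField x e i) y := fun i => by
        rw [(hg i).2.2 _ (isTestFunction_bumpField he hBe i), neg_neg]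
      simp only [h2, Finset.sum_neg_distrib]
      rw [← integral_finsetSum, ← integral_neg]
      · refine integral_congr_ae (Eventually.of_forall fun y => ?_)
        simp only [← Finset.mul_sum, sum_partialD_bumpField, mul_neg]
      · intro i _
        refine integrableOn_mul_of_closedBall hBe hfl hU.measurableSet
          (((contDiff_bumpField x e i).continuous_fderiv (by norm_num)).clm_apply
            continuous_const) fun y hy => ?_
        have : bumpField x e i =ᶠ[𝓝 y] fun _ => 0 := by
          filter_upwards [Metric.isClosed_closedBall.isOpen_compl.mem_nhds hy] with z hz
          exact bumpField_eq_zero he i hz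
        rw [partialD, this.fderiv_eq]; simp
    rw [h1]
    calc _ ≤ ∑ i, |∫ y in U, g i y * bumpField x e i y| := Finset.abs_sum_le_sum_abs _ _
      _ ≤ ∑ _i : Fin n, e⁻¹ ^ n * (δ * a * (e ^ n) ^ (1 - 1 / p)) := by
        refine Finset.sum_le_sum fun i _ => ?_
        refine (abs_integral_mul_le_of_closedBall hU.measurableSet hBe (hg i).2.1 (fun y => abs_bumpField_le he i)
          fun y hy => bumpField_eq_zero he i hy).trans ?_
        refine mul_le_mul_of_nonneg_left ?_ (by positivity)
        exact integral_abs_closedBall_le hp1 hδ he ((hB e her).trans hxK)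
          ((hg i).2.1.integrableOn_compact_subset hBe (isCompact_closedBall x e)) (hgδ i)
      _ = n * a * δ * (e⁻¹ ^ n * (e ^ n) ^ (1 - 1 / p)) := by
        rw [Finset.sum_const, Finset.card_univ, Fintype.card_fin, nsmul_eq_mul]; ring
      _ = _ := by rw [hpow e he]
  have hFr : |F r| ≤ C₁ * δ := by
    have hBr := (hB r (by linarith)).trans hxU
    refine (abs_integral_mul_le_of_closedBall hU.measurableSet hBr hfl (fun y => ?_)
      fun y hy => bumpKernel_eq_zero hr hy).trans ((mul_le_mul_of_nonneg_left
        (integral_abs_closedBall_le hp1 hδ hr ((hB r (by linarith)).trans hxK)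
          (hfl.integrableOn_compact_subset hBr (isCompact_closedBall x r)) hfδ)
        (by positivity : 0 ≤ r⁻¹ ^ n)).trans (le_of_eq ?_))
    · rw [abs_of_nonneg (bumpKernel_nonneg hr)]; exact bumpKernel_le hr
    · simp only [C₁, ← hpow r hr]; ring
  have hdiff : ∀ e, 0 < e → e < r → |F r - F e| ≤ C₂ * δ := by
    intro e he her
    -- The comparison function is the antiderivative of the bound on `F'`. It is nonnegative at the
    -- left endpoint, so the estimate at `r` is uniform as `e → 0`.
    have hBd : ∀ t, 0 < t → HasDerivAt (fun t : ℝ => n * a * δ * (s⁻¹ * t ^ s))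
        (n * a * δ * t ^ (s - 1)) t := fun t ht => by
      refine (((Real.hasDerivAt_rpow_const (Or.inl ht.ne')).const_mul s⁻¹).const_mul
        (n * a * δ)).congr_deriv ?_
      field_simp
    have := image_norm_le_of_norm_deriv_right_le_deriv_boundary' (f := fun t => F t - F e) (f' := F')
      (a := e) (b := r) (B := fun t => n * a * δ * (s⁻¹ * t ^ s))
      (B' := fun t => n * a * δ * t ^ (s - 1))
      (fun t ht => ((hderiv t (by linarith [ht.1]) (by linarith [ht.2])).sub_const
        _).continuousAt.continuousWithinAt)
      (fun t ht => ((hderiv t (by linarith [ht.1]) (by linarith [ht.2])).sub_const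
        _).hasDerivWithinAt)
      (by simp only [sub_self, norm_zero]; positivity)
      (fun t ht => (hBd t (by linarith [ht.1])).continuousAt.continuousWithinAt)
      (fun t ht => (hBd t (by linarith [ht.1])).hasDerivWithinAt)
      (fun t ht => hF' t (by linarith [ht.1]) (by linarith [ht.2])) ⟨her.le, le_rfl⟩
    rw [Real.norm_eq_abs] at this
    refine this.trans (le_of_eq ?_)
    simp only [C₂]; ring
  have hFx : |c * f x| ≤ (C₁ + C₂) * δ := by
    have hlim := (tendsto_integral_bumpKernel hU hf
      (hxU (Metric.mem_closedBall_self (by linarith)))).abs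
    refine le_of_tendsto hlim ?_
    filter_upwards [Ioo_mem_nhdsGT hr] with e he
    have h1 := hdiff e he.1 he.2
    calc |F e| = |F r - (F r - F e)| := by congr 1; ring
      _ ≤ |F r| + |F r - F e| := abs_sub _ _
      _ ≤ _ := by linarith
  rw [abs_mul, abs_of_pos hc] at hFx
  rw [div_mul_eq_mul_div, le_div_iff₀ hc]
  linarith

/-- Convergence to zero in `W^{1,p}_loc`, `p > n`, implies locally uniform convergence. -/
theorem SobolevTendstoZero.eventually_abs_lt {ι : Type*} {m : ℕ} {U : Set (Space n)} {p : ℝ}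
    (hp : (n : ℝ) < p) (hU : IsOpen U) {A : ι → Space n → Matrix (Fin n) (Fin n) ℝ}
    {l : Filter ι} (hA : SobolevTendstoZero U p A l) (hA' : ∀ α, IsDiffusionMatrix m U p (A α))
    {K : Set (Space n)} (hK : IsCompact K) (hKU : K ⊆ U) (i j : Fin n) {η : ℝ} (hη : 0 < η) :
    ∀ᶠ α in l, ∀ x ∈ K, |A α x i j| < η := by
  obtain ⟨r', hr', hr'U⟩ := hK.exists_cthickening_subset_open hU hKU
  set K' := Metric.cthickening r' K
  have hK' : IsCompact K' := hK.cthickening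
  obtain ⟨C, hC0, hC⟩ := exists_morrey_bound i.pos hp (half_pos hr')
  -- The added `1` makes the final inequality strict and covers `C = 0`.
  set δ : ℝ := η / (C + 1)
  have hδ : 0 < δ := by positivity
  have hδ' : (0 : ENNReal) < ENNReal.ofReal δ := ENNReal.ofReal_pos.2 hδ
  obtain ⟨h1, h2⟩ := hA K' hK' hr'U i j
  filter_upwards [h1.eventually_le_const hδ',
    eventually_all.2 fun k => (h2 k).eventually_le_const hδ'] with α hα hα' x hx
  have hweak : ∀ k, HasWeakPartial U k (fun x => A α x i j)
      (weakPartial U k fun x => A α x i j) := fun k => by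
    have hex : ∃ g, HasWeakPartial U k (fun x => A α x i j) g :=
      (((hA' α).1 i j).2.2 k).imp fun g hg => hg.1
    rw [weakPartial, dif_pos hex]
    exact hex.choose_spec
  have := hC U K' hU hr'U _ _ ((hA' α).1 i j).1 hweak δ hδ.le hα hα' x
    (by rw [mul_div_cancel₀ _ two_ne_zero]; exact Metric.closedBall_subset_cthickening hx r')
  calc |A α x i j| ≤ C * δ := this
    _ < (C + 1) * δ := by linarith
    _ = η := by simp only [δ]; field_simp

end Morrey

/-! ### Global flows of bounded Lipschitz vector fields -/

section Flow

variable {E : Type*} [NormedAddCommGroup E] [NormedSpace ℝ E]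

theorem contDiff_of_tsupport {F : Type*} [NormedAddCommGroup F] [NormedSpace ℝ F]
    {k : WithTop ℕ∞} {f : E → F} (h : ∀ x ∈ tsupport f, ContDiffAt ℝ k f x) : ContDiff ℝ k f :=
  contDiff_iff_contDiffAt.2 fun x => by
    by_cases hx : x ∈ tsupport f
    · exact h x hx
    · exact (contDiffAt_const (c := (0 : F))).congr_of_eventuallyEq
        (notMem_tsupport_iff_eventuallyEq.1 hx)

/-- A compact set in an open set of a finite-dimensional space has a smooth cutoff function. -/
theorem exists_contDiff_cutoff [FiniteDimensional ℝ E] {K U : Set E} (hK : IsCompact K)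
    (hU : IsOpen U) (hKU : K ⊆ U) :
    ∃ χ : E → ℝ, ContDiff ℝ ∞ χ ∧ HasCompactSupport χ ∧ tsupport χ ⊆ U ∧
      ∀ᶠ x in 𝓝ˢ K, χ x = 1 := by
  have : ProperSpace E := FiniteDimensional.proper ℝ E
  obtain ⟨L, hL, hKL, hLU⟩ := exists_compact_between hK hU hKU
  obtain ⟨f, h1, h0, -⟩ := exists_contMDiffMap_one_nhds_of_subset_interior
    (n := ⊤) (modelWithCornersSelf ℝ E) hK.isClosed hKL
  have hts : tsupport f ⊆ L :=
    closure_minimal (fun x hx => by by_contra h; exact hx (h0 x h)) hL.isClosed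
  exact ⟨f, f.contMDiff.contDiff, hL.of_isClosed_subset (isClosed_tsupport _) hts,
    hts.trans hLU, h1⟩

/-- A `C¹` vector field on an open set agrees near a given compact subset with a globally
Lipschitz and bounded one. -/
theorem exists_lipschitz_bounded_extension [FiniteDimensional ℝ E] {K U : Set E} {V : E → E}
    (hK : IsCompact K) (hU : IsOpen U) (hKU : K ⊆ U) (hV : ContDiffOn ℝ 1 V U) :
    ∃ (Y : E → E) (C M : NNReal), LipschitzWith C Y ∧ (∀ x, ‖Y x‖ ≤ M) ∧
      ∀ᶠ x in 𝓝ˢ K, Y x = V x := by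
  obtain ⟨χ, hχ, hχc, hχU, hχ1⟩ := exists_contDiff_cutoff hK hU hKU
  have hYsupp : tsupport (fun x => χ x • V x) ⊆ tsupport χ :=
    closure_mono fun x hx => by
      intro h0; exact hx (by simp [h0])
  have hYc : HasCompactSupport (fun x => χ x • V x) :=
    hχc.of_isClosed_subset (isClosed_tsupport _) hYsupp
  have hY : ContDiff ℝ 1 (fun x => χ x • V x) := contDiff_of_tsupport fun x hx =>
    (hχ.contDiffAt.of_le (by norm_cast)).smul
      ((hV x (hχU (hYsupp hx))).contDiffAt (hU.mem_nhds (hχU (hYsupp hx))))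
  obtain ⟨C, hC⟩ := ContDiff.lipschitzWith_of_hasCompactSupport hYc hY one_ne_zero
  obtain ⟨M, hM⟩ := hYc.exists_bound_of_continuous hY.continuous
  refine ⟨_, C, M.toNNReal, hC, fun x => (hM x).trans (Real.le_coe_toNNReal M), ?_⟩
  filter_upwards [hχ1] with x hx
  simp [hx]

/-- `Φ` is the global flow of the vector field `Y`. -/
structure IsGlobalFlow (Y : E → E) (Φ : ℝ → E → E) : Prop where
  zero : ∀ x, Φ 0 x = x
  hasDerivAt : ∀ x t, HasDerivAt (fun s => Φ s x) (Y (Φ t x)) t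

/-- A bounded Lipschitz vector field has a global flow. -/
theorem exists_isGlobalFlow [CompleteSpace E] {Y : E → E} {C M : NNReal} (hC : LipschitzWith C Y)
    (hM : ∀ x, ‖Y x‖ ≤ M) : ∃ Φ, IsGlobalFlow Y Φ := by
  -- The field is bounded everywhere, so Picard–Lindelöf may be run in a ball of radius `M T`, which
  -- gives solutions on arbitrarily long intervals.
  have key : ∀ x : E, ∀ T : ℝ, 0 < T → ∃ γ : ℝ → E, γ 0 = x ∧
      ∀ t ∈ Ioo (-T) T, HasDerivAt γ (Y (γ t)) t := by
    intro x T hT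
    have h0 : (0 : ℝ) ∈ Icc (-T) T := ⟨by linarith, hT.le⟩
    have hpl : IsPicardLindelof (fun _ : ℝ => Y) (⟨0, h0⟩ : Icc (-T) T) x
        (M * T.toNNReal) 0 M C :=
      { lipschitzOnWith := fun t _ => hC.lipschitzOnWith
        continuousOn := fun x _ => continuousOn_const
        norm_le := fun t _ y _ => hM y
        mul_max_le := by simp [hT.le] }
    obtain ⟨γ, h1, h2⟩ := hpl.exists_eq_forall_mem_Icc_hasDerivWithinAt₀
    exact ⟨γ, h1, fun t ht => (h2 t (Ioo_subset_Icc_self ht)).hasDerivAt (Icc_mem_nhds ht.1 ht.2)⟩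
  choose γ h0 hγ using key
  have hpos : ∀ t : ℝ, 0 < |t| + 1 := fun t => by positivity
  have heq : ∀ x (S T : ℝ) (hS : 0 < S) (hT : 0 < T) (t), t ∈ Ioo (-S) S → t ∈ Ioo (-T) T →
      γ x S hS t = γ x T hT t := by
    intro x S T hS hT t htS htT
    have hm : 0 < min S T := lt_min hS hT
    refine ODE_solution_unique_of_mem_Ioo (v := fun _ => Y) (s := fun _ => univ) (K := C)
      (a := -min S T) (b := min S T) (t₀ := 0) (fun t _ => hC.lipschitzOnWith)
      ⟨by linarith, hm⟩ (fun s hs => ⟨hγ x S hS s ?_, trivial⟩)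
      (fun s hs => ⟨hγ x T hT s ?_, trivial⟩) (by rw [h0, h0]) ?_ <;>
    simp only [mem_Ioo, neg_lt, lt_min_iff] at * <;> tauto
  -- Each time is read off from a solution whose interval contains it in the interior. By
  -- uniqueness, nearby times see the same curve.
  refine ⟨fun t x => γ x (|t| + 1) (hpos t) t, fun x => h0 _ _ _, fun x t => ?_⟩
  have ht : t ∈ Ioo (-(|t| + 1)) (|t| + 1) :=
    ⟨by linarith [neg_abs_le t], by linarith [le_abs_self t]⟩
  refine (hγ x (|t| + 1) (hpos t) t ht).congr_of_eventuallyEq ?_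
  filter_upwards [isOpen_Ioo.mem_nhds ht] with s hs
  exact heq _ _ _ _ _ _ ⟨by linarith [neg_abs_le s], by linarith [le_abs_self s]⟩ hs

namespace IsGlobalFlow

variable {Y : E → E} {Φ : ℝ → E → E} {C M : NNReal}

theorem continuous_time (hΦ : IsGlobalFlow Y Φ) (x : E) : Continuous fun t => Φ t x :=
  continuous_iff_continuousAt.2 fun t => (hΦ.hasDerivAt x t).continuousAt

theorem add (hΦ : IsGlobalFlow Y Φ) (hC : LipschitzWith C Y) (s t : ℝ) (x : E) :
    Φ (s + t) x = Φ s (Φ t x) := by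
  have := ODE_solution_unique_univ (v := fun _ => Y) (s := fun _ => univ) (K := C) (t₀ := 0)
    (f := fun s => Φ (s + t) x) (g := fun s => Φ s (Φ t x))
    (fun t => hC.lipschitzOnWith) (fun s => ⟨(hΦ.hasDerivAt x (s + t)).comp_add_const s t, trivial⟩)
    (fun s => ⟨hΦ.hasDerivAt _ s, trivial⟩) (by simp [hΦ.zero])
  exact congrFun this s

theorem injective (hΦ : IsGlobalFlow Y Φ) (hC : LipschitzWith C Y) (t : ℝ) :
    Function.Injective (Φ t) := fun x y h => by
  have : Φ (-t) (Φ t x) = Φ (-t) (Φ t y) := by rw [h]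
  simpa [← hΦ.add hC, hΦ.zero] using this

theorem dist_le (hΦ : IsGlobalFlow Y Φ) (hC : LipschitzWith C Y) {t : ℝ} (ht : 0 ≤ t) (x y : E) :
    dist (Φ t x) (Φ t y) ≤ Real.exp (C * t) * dist x y := by
  have := dist_le_of_trajectories_ODE (v := fun _ => Y) (K := C) (f := fun s => Φ s x)
    (g := fun s => Φ s y) (a := 0) (b := t) (δ := dist x y) (fun _ => hC)
    (hΦ.continuous_time x).continuousOn (fun s _ => (hΦ.hasDerivAt x s).hasDerivWithinAt)
    (hΦ.continuous_time y).continuousOn (fun s _ => (hΦ.hasDerivAt y s).hasDerivWithinAt)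
    (by simp [hΦ.zero]) t ⟨ht, le_rfl⟩
  simpa [mul_comm] using this

theorem continuous_space (hΦ : IsGlobalFlow Y Φ) (hC : LipschitzWith C Y) {t : ℝ} (ht : 0 ≤ t) :
    Continuous (Φ t) :=
  (LipschitzWith.of_dist_le_mul (K := ⟨Real.exp (C * t), (Real.exp_pos _).le⟩)
    fun x y => hΦ.dist_le hC ht x y).continuous

theorem dist_self_le (hΦ : IsGlobalFlow Y Φ) (hM : ∀ x, ‖Y x‖ ≤ M) {t : ℝ} (ht : 0 ≤ t) (x : E) :
    ‖Φ t x - x‖ ≤ M * t := by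
  have := norm_image_sub_le_of_norm_deriv_le_segment' (f := fun s => Φ s x) (a := 0) (b := t)
    (fun s _ => (hΦ.hasDerivAt x s).hasDerivWithinAt) (fun s _ => hM _) t ⟨ht, le_rfl⟩
  simpa [hΦ.zero] using this

/-- First-order expansion of the flow, with the velocity taken at a nearby point. -/
theorem norm_sub_sub_smul_le (hΦ : IsGlobalFlow Y Φ) (hC : LipschitzWith C Y)
    (hM : ∀ x, ‖Y x‖ ≤ M) {t : ℝ} (ht : 0 ≤ t) (x z : E) :
    ‖Φ t z - z - t • Y x‖ ≤ C * (M * t + ‖z - x‖) * t := by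
  have := norm_image_sub_le_of_norm_deriv_le_segment' (f := fun s => Φ s z - s • Y x)
    (f' := fun s => Y (Φ s z) - Y x) (a := 0) (b := t) (C := C * (M * t + ‖z - x‖))
    (fun s _ => by
      simpa using! ((hΦ.hasDerivAt z s).sub ((hasDerivAt_id s).smul_const (Y x))).hasDerivWithinAt)
    (fun s hs => by
      rw [← dist_eq_norm]
      refine (hC.dist_le_mul _ _).trans (mul_le_mul_of_nonneg_left ?_ C.2)
      rw [dist_eq_norm]
      calc ‖Φ s z - x‖ = ‖(Φ s z - z) + (z - x)‖ := by congr 1; abel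
        _ ≤ ‖Φ s z - z‖ + ‖z - x‖ := norm_add_le _ _
        _ ≤ M * t + ‖z - x‖ := by
          gcongr
          exact (hΦ.dist_self_le hM hs.1 z).trans (mul_le_mul_of_nonneg_left hs.2.le M.2))
    t ⟨ht, le_rfl⟩
  simpa [hΦ.zero, sub_right_comm] using this

end IsGlobalFlow

end Flow

/-- If the increments of `m` are at most `a` times the increment of the variable, up to second
order, then the same holds for the total increment. -/
theorem abs_sub_le_of_increment_le {m : ℝ → ℝ} {T a b : ℝ} (hT : 0 ≤ T)
    (h : ∀ s r, 0 ≤ s → 0 ≤ r → s + r ≤ T → |m (s + r) - m s| ≤ r * (a + b * r)) :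
    |m T - m 0| ≤ T * a := by
  -- Cut `[0, T]` into `N + 1` equal steps. The second-order errors add up to `T b T / (N + 1)` and
  -- vanish in the limit.
  have key : ∀ N : ℕ, |m T - m 0| ≤ T * (a + b * (T / (N + 1 : ℕ))) := by
    intro N
    have hN : (0 : ℝ) < (N + 1 : ℕ) := by positivity
    set r : ℝ := T / (N + 1 : ℕ) with hr
    have hr0 : 0 ≤ r := by positivity
    have hNr : ((N + 1 : ℕ) : ℝ) * r = T := by rw [hr]; field_simp
    have := dist_le_range_sum_of_dist_le (f := fun k : ℕ => m (k * r))
      (d := fun _ => r * (a + b * r)) (N + 1) (fun {k} hk => by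
        have hk' : ((k + 1 : ℕ) : ℝ) ≤ (N + 1 : ℕ) := by exact_mod_cast hk
        have h1 := h (k * r) r (by positivity) hr0 (by
          calc k * r + r = ((k + 1 : ℕ) : ℝ) * r := by push_cast; ring
            _ ≤ (N + 1 : ℕ) * r := by gcongr
            _ = T := hNr)
        rw [dist_comm, Real.dist_eq]
        convert h1 using 4
        push_cast; ring)
    simp only [hNr, Finset.sum_const, Finset.card_range, nsmul_eq_mul, Nat.cast_zero, zero_mul]
      at this
    rw [dist_comm, Real.dist_eq, ← mul_assoc, hNr] at this
    exact this
  have hlim : Tendsto (fun N : ℕ => T * (a + b * (T / (N + 1 : ℕ)))) atTop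
      (𝓝 (T * (a + b * 0))) := by
    refine Tendsto.const_mul _ (tendsto_const_nhds.add (Tendsto.const_mul _ ?_))
    exact (tendsto_const_div_atTop_nhds_zero_nat T).comp (tendsto_add_atTop_nat 1)
  simpa using ge_of_tendsto' hlim key

/-! ### Mollification estimates -/

section Mollify

variable {E : Type*} [NormedAddCommGroup E] [NormedSpace ℝ E] [FiniteDimensional ℝ E]
  [MeasurableSpace E]
  {F : Type*} [NormedAddCommGroup F] [NormedSpace ℝ F]

/-- Mollification by a normalized bump function. -/
noncomputable def mollify (μ : Measure E) (φ : ContDiffBump (0 : E)) (u : E → F) : E → F :=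
  convolution (φ.normed μ) u (ContinuousLinearMap.lsmul ℝ ℝ) μ

theorem mollify_apply {μ : Measure E} (φ : ContDiffBump (0 : E)) (u : E → F) (x : E) :
    mollify μ φ u x = ∫ y, φ.normed μ y • u (x - y) ∂μ := rfl

variable [BorelSpace E] {μ : Measure E} [μ.IsAddHaarMeasure]

theorem integrable_normed_smul (φ : ContDiffBump (0 : E)) {f : E → F} (hf : Continuous f) :
    Integrable (fun y => φ.normed μ y • f y) μ :=
  (φ.continuous_normed.smul hf).integrable_of_hasCompactSupport
    φ.hasCompactSupport_normed.smul_right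

theorem norm_integral_normed_smul_sub_le [CompleteSpace F] (φ : ContDiffBump (0 : E)) {f g : E → F}
    (hf : Continuous f) (hg : Continuous g) {δ : ℝ}
    (h : ∀ y, ‖y‖ ≤ φ.rOut → ‖f y - g y‖ ≤ δ) :
    ‖(∫ y, φ.normed μ y • f y ∂μ) - ∫ y, φ.normed μ y • g y ∂μ‖ ≤ δ := by
  rw [← integral_sub (integrable_normed_smul φ hf) (integrable_normed_smul φ hg)]
  calc _ ≤ ∫ y, φ.normed μ y * δ ∂μ := by
        refine norm_integral_le_of_norm_le (φ.integrable_normed.mul_const δ)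
          (Eventually.of_forall fun y => ?_)
        rw [← smul_sub, norm_smul, Real.norm_of_nonneg (φ.nonneg_normed y)]
        by_cases hy : ‖y‖ ≤ φ.rOut
        · exact mul_le_mul_of_nonneg_left (h y hy) (φ.nonneg_normed y)
        · have : y ∉ Function.support (φ.normed μ) := by
            rw [φ.support_normed_eq]; simpa using (not_le.1 hy).le
          simp [Function.notMem_support.1 this]
    _ = δ := by rw [integral_mul_const, φ.integral_normed, one_mul]

theorem norm_mollify_sub_le [CompleteSpace F] (φ : ContDiffBump (0 : E)) {u : E → F}
    (hu : Continuous u) {x : E} {δ : ℝ} (h : ∀ y, ‖y‖ ≤ φ.rOut → ‖u (x - y) - u x‖ ≤ δ) :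
    ‖mollify μ φ u x - u x‖ ≤ δ := by
  have := norm_integral_normed_smul_sub_le (μ := μ) φ (f := fun y => u (x - y))
    (g := fun _ => u x) (by fun_prop) continuous_const h
  rwa [integral_smul_const, φ.integral_normed, one_smul] at this

theorem contDiff_mollify [CompleteSpace F] (φ : ContDiffBump (0 : E)) {u : E → F}
    (hu : Continuous u) : ContDiff ℝ ∞ (mollify μ φ u) :=
  φ.hasCompactSupport_normed.contDiff_convolution_left _ φ.contDiff_normed hu.locallyIntegrable

/-- The derivative of a mollification is Lipschitz, with a constant that depends only on the
mollifier and the Lipschitz constant of the function. -/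
theorem exists_lipschitz_fderiv_mollify (φ : ContDiffBump (0 : E)) (L : NNReal) :
    ∃ D : ℝ, 0 ≤ D ∧ ∀ u : E → ℝ, LipschitzWith L u → ∀ x z : E,
      ‖fderiv ℝ (mollify μ φ u) x - fderiv ℝ (mollify μ φ u) z‖ ≤ D * ‖x - z‖ := by
  have hφ1 : ContDiff ℝ 1 (φ.normed μ) := φ.contDiff_normed
  have hdc : Continuous (fderiv ℝ (φ.normed μ)) := hφ1.continuous_fderiv one_ne_zero
  have hds : HasCompactSupport (fderiv ℝ (φ.normed μ)) := φ.hasCompactSupport_normed.fderiv ℝ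
  have hdi : Integrable (fun y => ‖fderiv ℝ (φ.normed μ) y‖) μ :=
    (hdc.integrable_of_hasCompactSupport hds).norm
  refine ⟨(∫ y, ‖fderiv ℝ (φ.normed μ) y‖ ∂μ) * L, by positivity, fun u hu x z => ?_⟩
  -- The derivative is placed on the kernel, because `u` is only Lipschitz.
  have hder : ∀ x, fderiv ℝ (mollify μ φ u) x = ∫ y, u (x - y) • fderiv ℝ (φ.normed μ) y ∂μ := by
    intro x
    have := (φ.hasCompactSupport_normed.hasFDerivAt_convolution_left
      (ContinuousLinearMap.lsmul ℝ ℝ) hφ1 (hu.continuous.locallyIntegrable (μ := μ)) x).fderiv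
    rw [show mollify μ φ u = convolution (φ.normed μ) u (ContinuousLinearMap.lsmul ℝ ℝ) μ from rfl,
      this, convolution_def]
    congr 1
    ext y v
    simp [ContinuousLinearMap.precompL_apply, mul_comm]
  have hint : ∀ x, Integrable (fun y => u (x - y) • fderiv ℝ (φ.normed μ) y) μ := fun x =>
    ((hu.continuous.comp (by fun_prop)).smul hdc).integrable_of_hasCompactSupport hds.smul_left
  rw [hder, hder, ← integral_sub (hint x) (hint z)]
  calc _ ≤ ∫ y, ‖fderiv ℝ (φ.normed μ) y‖ * (L * ‖x - z‖) ∂μ := by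
        refine norm_integral_le_of_norm_le (hdi.mul_const _) (Eventually.of_forall fun y => ?_)
        rw [← sub_smul, norm_smul, mul_comm]
        refine mul_le_mul_of_nonneg_left ?_ (norm_nonneg _)
        have := hu.dist_le_mul (x - y) (z - y)
        rwa [dist_eq_norm, dist_eq_norm, sub_sub_sub_cancel_right] at this
    _ = _ := by rw [integral_mul_const]; ring

end Mollify

/-! ### From the infinitesimal equation to invariance under the flow -/

section Invariance

variable {E : Type*} [NormedAddCommGroup E] [NormedSpace ℝ E] [FiniteDimensional ℝ E]
  [MeasurableSpace E] [BorelSpace E]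

theorem integrable_of_continuous_of_compl_null {F : Type*} [NormedAddCommGroup F] {ν : Measure E}
    [IsFiniteMeasure ν] {K : Set E} (hK : IsCompact K) (hνK : ν Kᶜ = 0) {f : E → F}
    (hf : Continuous f) : Integrable f ν := by
  have := hf.continuousOn.integrableOn_compact (μ := ν) hK
  rwa [IntegrableOn, Measure.restrict_eq_self_of_ae_mem (measure_eq_zero_iff_ae_notMem.1 hνK |>.mono
    fun x hx => not_not.1 hx)] at this

/-- A compactly supported measure that annihilates the derivatives of smooth functions along a
bounded Lipschitz vector field is invariant under the flow. -/
theorem integral_comp_flow_eq {ν : Measure E} [IsFiniteMeasure ν] {K : Set E} (hK : IsCompact K)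
    (hνK : ν Kᶜ = 0) {Y : E → E} {Φ : ℝ → E → E} {C M : NNReal} (hΦ : IsGlobalFlow Y Φ)
    (hC : LipschitzWith C Y) (hM : ∀ x, ‖Y x‖ ≤ M)
    (hν : ∀ G : E → ℝ, ContDiff ℝ ∞ G → ∫ x, fderiv ℝ G x (Y x) ∂ν = 0)
    {f : E → ℝ} {L₀ : NNReal} (hf : LipschitzWith L₀ f) {T : ℝ} (hT : 0 ≤ T) :
    ∫ x, f (Φ T x) ∂ν = ∫ x, f x ∂ν := by
  let lam : Measure E := Measure.addHaar
  set c : ℝ := ν.real univ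
  -- By Gronwall, this is one Lipschitz constant for all the functions `f ∘ Φ s`, `0 ≤ s ≤ T`.
  set L : NNReal := L₀ * (Real.exp (C * T)).toNNReal with hL
  have huc : ∀ s, 0 ≤ s → Continuous fun x => f (Φ s x) := fun s hs =>
    hf.continuous.comp (hΦ.continuous_space hC hs)
  have hu : ∀ s, 0 ≤ s → s ≤ T → LipschitzWith L fun x => f (Φ s x) := fun s hs hsT =>
    LipschitzWith.of_dist_le_mul fun x y => by
      refine (hf.dist_le_mul _ _).trans ?_
      rw [hL, NNReal.coe_mul, Real.coe_toNNReal _ (Real.exp_pos _).le, mul_assoc]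
      refine mul_le_mul_of_nonneg_left ((hΦ.dist_le hC hs x y).trans ?_) L₀.2
      refine mul_le_mul_of_nonneg_right (Real.exp_le_exp.2 ?_) dist_nonneg
      exact mul_le_mul_of_nonneg_left hsT C.2
  -- The function `f ∘ Φ s` solves the transport equation but is too rough to test with. Its
  -- mollification `w s` at scale `ε` is smooth and solves the equation up to a commutator of size
  -- `L C ε`. The constant `D` may blow up as `ε → 0`, but it enters only through terms quadratic in
  -- the time step, which disappear before `ε` is sent to zero.
  have key : ∀ ε : ℝ, 0 < ε → |(∫ x, f (Φ T x) ∂ν) - ∫ x, f x ∂ν| ≤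
      (T * (c * (L * C)) + 2 * (c * L)) * ε := by
    intro ε hε
    let φ : ContDiffBump (0 : E) := ⟨ε / 2, ε, half_pos hε, half_lt_self hε⟩
    have hφ : φ.rOut = ε := rfl
    obtain ⟨D, hD0, hD⟩ := exists_lipschitz_fderiv_mollify (μ := lam) φ L
    let w : ℝ → E → ℝ := fun s => mollify lam φ fun x => f (Φ s x)
    have hw : ∀ s, 0 ≤ s → ContDiff ℝ ∞ (w s) := fun s hs => contDiff_mollify φ (huc s hs)
    have hwi : ∀ s, 0 ≤ s → Integrable (w s) ν := fun s hs =>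
      integrable_of_continuous_of_compl_null hK hνK (hw s hs).continuous
    have happrox : ∀ s, 0 ≤ s → s ≤ T →
        |(∫ x, w s x ∂ν) - ∫ x, f (Φ s x) ∂ν| ≤ c * L * ε := by
      intro s hs hsT
      rw [← integral_sub (hwi s hs) (integrable_of_continuous_of_compl_null hK hνK (huc s hs))]
      have hb : ∀ x, ‖w s x - f (Φ s x)‖ ≤ L * ε := fun x => ?_
      · refine (norm_integral_le_of_norm_le_const (Eventually.of_forall hb)).trans (le_of_eq ?_)
        ring
      refine norm_mollify_sub_le φ (huc s hs) fun y hy => ?_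
      have := (hu s hs hsT).dist_le_mul (x - y) x
      rw [dist_eq_norm, dist_eq_norm, sub_sub_cancel_left, norm_neg] at this
      exact this.trans (mul_le_mul_of_nonneg_left (hφ ▸ hy) L.2)
    have hpt : ∀ s r, 0 ≤ s → 0 ≤ r → s + r ≤ T → ∀ x,
        |w (s + r) x - w s x - r * fderiv ℝ (w s) x (Y x)| ≤
          r * (L * C * ε + (L * C * M + D * M ^ 2) * r) := by
      intro s r hs hr hsr x
      have hLs := hu s hs (by linarith)
      -- The commutator estimate: inside the mollification, moving `x - y` by the flow is compared
      -- with translating it by `r • Y x`. The velocities differ by at most `C (M r + ε)`.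
      have h1 : |w (s + r) x - w s (x + r • Y x)| ≤ L * (C * (M * r + ε) * r) := by
        have h2 : w (s + r) x = ∫ y, φ.normed lam y • f (Φ s (Φ r (x - y))) ∂lam := by
          simp only [w, mollify_apply, hΦ.add hC]
        rw [h2]
        refine norm_integral_normed_smul_sub_le φ (f := fun y => f (Φ s (Φ r (x - y))))
          (g := fun y => f (Φ s (x + r • Y x - y)))
          ((huc s hs).comp ((hΦ.continuous_space hC hr).comp (by fun_prop)))
          ((huc s hs).comp (by fun_prop)) fun y hy => ?_
        have h3 := hLs.dist_le_mul (Φ r (x - y)) (x + r • Y x - y)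
        rw [dist_eq_norm, dist_eq_norm] at h3
        refine h3.trans (mul_le_mul_of_nonneg_left ?_ L.2)
        have h4 := hΦ.norm_sub_sub_smul_le hC hM hr x (x - y)
        rw [sub_sub_cancel_left, norm_neg] at h4
        calc _ = ‖Φ r (x - y) - (x - y) - r • Y x‖ := by congr 1; abel
          _ ≤ _ := h4
          _ ≤ _ := by gcongr
      -- A second-order Taylor bound, with the Lipschitz constant `D` of the mollified gradient.
      have h5 : |w s (x + r • Y x) - w s x - r * fderiv ℝ (w s) x (Y x)| ≤
          D * (M * r) * (M * r) := by
        have hrY : ‖r • Y x‖ ≤ M * r := by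
          rw [norm_smul, Real.norm_of_nonneg hr, mul_comm]
          exact mul_le_mul_of_nonneg_right (hM x) hr
        have h6 := (convex_segment x (x + r • Y x)).norm_image_sub_le_of_norm_fderiv_le'
          (f := w s) (C := D * (M * r)) (φ := fderiv ℝ (w s) x)
          (fun z _ => (hw s hs).differentiable (by norm_num) z)
          (fun z hz => (hD _ hLs z x).trans (mul_le_mul_of_nonneg_left ?_ hD0))
          (left_mem_segment ℝ _ _) (right_mem_segment ℝ _ _)
        · rw [add_sub_cancel_left, map_smul, smul_eq_mul] at h6
          exact h6.trans (mul_le_mul_of_nonneg_left hrY (by positivity))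
        · have := norm_sub_le_of_mem_segment hz
          rw [add_sub_cancel_left] at this
          exact this.trans hrY
      calc _ = |(w (s + r) x - w s (x + r • Y x)) +
            (w s (x + r • Y x) - w s x - r * fderiv ℝ (w s) x (Y x))| := by congr 1; ring
        _ ≤ _ := abs_add_le _ _
        _ ≤ L * (C * (M * r + ε) * r) + D * (M * r) * (M * r) := add_le_add h1 h5
        _ = _ := by ring
    have hinc : ∀ s r, 0 ≤ s → 0 ≤ r → s + r ≤ T →
        |(∫ x, w (s + r) x ∂ν) - ∫ x, w s x ∂ν| ≤
          r * (c * (L * C * ε) + c * (L * C * M + D * M ^ 2) * r) := by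
      intro s r hs hr hsr
      have hdi : Integrable (fun x => r * fderiv ℝ (w s) x (Y x)) ν :=
        integrable_of_continuous_of_compl_null hK hνK (continuous_const.mul
          (((hw s hs).continuous_fderiv (by norm_num)).clm_apply hC.continuous))
      -- The first-order term may be subtracted for free: `ν` annihilates the derivative of `w s`
      -- along `Y`.
      have : (∫ x, w (s + r) x ∂ν) - ∫ x, w s x ∂ν =
          ∫ x, (w (s + r) x - w s x - r * fderiv ℝ (w s) x (Y x)) ∂ν := by
        rw [integral_sub (f := fun x => w (s + r) x - w s x)
            ((hwi _ (by positivity)).sub (hwi s hs)) hdi,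
          integral_sub (hwi _ (by positivity)) (hwi s hs), integral_const_mul, hν _ (hw s hs)]
        ring
      rw [this]
      refine (norm_integral_le_of_norm_le_const (Eventually.of_forall fun x =>
        (Real.norm_eq_abs _).trans_le (hpt s r hs hr hsr x))).trans (le_of_eq ?_)
      ring
    have h1 := abs_sub_le_of_increment_le (m := fun s => ∫ x, w s x ∂ν) hT hinc
    have h2 := happrox T hT le_rfl
    have h3 := happrox 0 le_rfl hT
    simp only [hΦ.zero] at h3
    rw [abs_le] at *
    constructor <;> nlinarith [h1.1, h1.2, h2.1, h2.2, h3.1, h3.2]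
  have hlim : Tendsto (fun ε : ℝ => (T * (c * (L * C)) + 2 * (c * L)) * ε) (𝓝[>] 0)
      (𝓝 ((T * (c * (L * C)) + 2 * (c * L)) * 0)) :=
    (Continuous.tendsto (by fun_prop) 0).mono_left nhdsWithin_le_nhds
  rw [mul_zero] at hlim
  have := ge_of_tendsto hlim (eventually_mem_nhdsWithin.mono fun ε hε => key ε hε)
  exact sub_eq_zero.1 (abs_eq_zero.1 (le_antisymm this (abs_nonneg _)))

/-- Under the same assumptions, the mass of a closed set does not exceed that of its image under
the flow, if the image is closed. -/
theorem measure_le_measure_flow_image {ν : Measure E} [IsFiniteMeasure ν] {K : Set E}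
    (hK : IsCompact K) (hνK : ν Kᶜ = 0) {Y : E → E} {Φ : ℝ → E → E} {C M : NNReal}
    (hΦ : IsGlobalFlow Y Φ) (hC : LipschitzWith C Y) (hM : ∀ x, ‖Y x‖ ≤ M)
    (hν : ∀ G : E → ℝ, ContDiff ℝ ∞ G → ∫ x, fderiv ℝ G x (Y x) ∂ν = 0)
    {B : Set E} (hB : IsCompact B) {T : ℝ} (hT : 0 ≤ T) : ν B ≤ ν (Φ T '' B) := by
  have hΦc := hΦ.continuous_space hC hT
  set S := Φ T '' B
  have hS : IsClosed S := (hB.image hΦc).isClosed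
  -- Thickened indicators are Lipschitz, so invariance applies to them. They decrease to the
  -- indicator of the image, and composed with `Φ T` they equal one on `B`.
  have hlim := tendsto_lintegral_thickenedIndicator_of_isClosed ν hS
    (δs := fun k : ℕ => 1 / ((k : ℝ) + 1)) (fun _ => by positivity)
    tendsto_one_div_add_atTop_nhds_zero_nat
  refine ge_of_tendsto' hlim fun k => ?_
  have hδ : (0 : ℝ) < 1 / ((k : ℝ) + 1) := by positivity
  set g := thickenedIndicator hδ S
  have hgL : LipschitzWith _ g := lipschitzWith_thickenedIndicator hδ S
  have hfR : LipschitzWith (1 / ((k : ℝ) + 1)).toNNReal⁻¹ (fun x => ((g x : NNReal) : ℝ)) :=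
    fun x y => hgL x y
  have h1 := integral_comp_flow_eq hK hνK hΦ hC hM hν hfR hT
  have hconv : ∀ h : E → NNReal, Continuous h →
      ∫⁻ x, (h x : ENNReal) ∂ν = ENNReal.ofReal (∫ x, (h x : ℝ) ∂ν) := fun h hh => by
    have hi : Integrable (fun x => (h x : ℝ)) ν :=
      integrable_of_continuous_of_compl_null hK hνK (by fun_prop)
    rw [ofReal_integral_eq_lintegral_ofReal hi (Eventually.of_forall fun x => NNReal.coe_nonneg _)]
    simp
  calc ν B = ∫⁻ x, B.indicator 1 x ∂ν := by rw [lintegral_indicator_one hB.measurableSet]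
    _ ≤ ∫⁻ x, (g (Φ T x) : ENNReal) ∂ν := lintegral_mono fun x => by
        by_cases hx : x ∈ B
        · have h2 : g (Φ T x) = 1 := thickenedIndicator_one hδ S (mem_image_of_mem (Φ T) hx)
          simp [hx, h2]
        · simp [hx]
    _ = ∫⁻ x, (g x : ENNReal) ∂ν := by
        rw [hconv (fun x => g (Φ T x)) (g.continuous.comp hΦc), hconv _ g.continuous, h1]

end Invariance

/-! ### The limit equation -/

section LimitEquation

variable {n : ℕ}

theorem sum_mul_partialD_eq_fderiv (V : Space n → Space n) (f : Space n → ℝ) (x : Space n) :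
    ∑ i, V x i * partialD i f x = fderiv ℝ f x (V x) :=
  (fderiv_apply_eq_sum_partialD f x (V x)).symm

theorem fderiv_eq_zero_of_notMem_tsupport {f : Space n → ℝ} {x : Space n} (hx : x ∉ tsupport f) :
    fderiv ℝ f x = 0 :=
  image_eq_zero_of_notMem_tsupport fun h => hx (tsupport_fderiv_subset ℝ h)

/-- The derivative of a compactly supported `C¹` function along a continuous vector field is
continuous and bounded. -/
theorem exists_bound_fderiv_apply {U : Set (Space n)} {V : Space n → Space n}
    (hV : ContinuousOn V U) {F : Space n → ℝ} (hF : ContDiff ℝ 1 F) (hFc : HasCompactSupport F)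
    (hFU : tsupport F ⊆ U) :
    Continuous (fun x : U => fderiv ℝ F x (V x)) ∧ ∃ S, ∀ x : U, ‖fderiv ℝ F x (V x)‖ ≤ S := by
  have hF' := hF.continuous_fderiv one_ne_zero
  refine ⟨(hF'.comp continuous_subtype_val).clm_apply (continuousOn_iff_continuous_domRestrict.1 hV),
    ?_⟩
  obtain ⟨S, hS⟩ := hFc.isCompact.exists_bound_of_continuousOn (f := fun x => fderiv ℝ F x (V x))
    (hF'.continuousOn.clm_apply (hV.mono hFU))
  refine ⟨max S 0, fun x => ?_⟩
  by_cases hx : (x : Space n) ∈ tsupport F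
  · exact (hS x hx).trans (le_max_left _ _)
  · simp [fderiv_eq_zero_of_notMem_tsupport hx]

/-- At a fixed point the second-order expressions are constants multiplied by coefficients tending
to zero, so no regularity of `f` is needed. Applied to a Lyapunov function, this removes the
diffusion from its inequality. -/
theorem tendsto_adjointFP {m : ℕ} {U : Set (Space n)} (hU : IsOpen U) {p : ℝ}
    (hp : (n : ℝ) < p) {ι : Type*} {l : Filter ι} {V : Space n → Space n}
    {A : ι → Space n → Matrix (Fin n) (Fin n) ℝ} (hA : SobolevTendstoZero U p A l)
    (hA' : ∀ α, IsDiffusionMatrix m U p (A α)) (f : Space n → ℝ) {x : Space n} (hx : x ∈ U) :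
    Tendsto (fun α => adjointFP V (A α) f x) l (𝓝 (fderiv ℝ f x (V x))) := by
  have h0 : ∀ i j, Tendsto (fun α => A α x i j) l (𝓝 0) := fun i j => by
    refine Metric.tendsto_nhds.2 fun η hη => ?_
    filter_upwards [hA.eventually_abs_lt hp hU hA' isCompact_singleton
      (singleton_subset_iff.2 hx) i j hη] with α hα
    simpa using hα x rfl
  simp only [adjointFP, sum_mul_partialD_eq_fderiv]
  have := (tendsto_finsetSum Finset.univ fun i _ => tendsto_finsetSum Finset.univ fun j _ =>
    (h0 i j).mul_const (partialD i (partialD j f) x)).add_const (fderiv ℝ f x (V x))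
  simpa using this

/-- A limit measure annihilates the derivatives of test functions along the drift. -/
theorem IsLimitMeasure.integral_fderiv_eq_zero {m : ℕ} {U : Set (Space n)} (hU : IsOpen U) {p : ℝ}
    (hp : (n : ℝ) < p) {ι : Type*} {V : Space n → Space n} (hV : ContinuousOn V U)
    {A : ι → Space n → Matrix (Fin n) (Fin n) ℝ} (hA : ∀ α, IsDiffusionMatrix m U p (A α))
    {μ : ProbabilityMeasure U} (hμ : IsLimitMeasure U p V A μ) {F : Space n → ℝ}
    (hF : IsTestFunction U F) : ∫ x : U, fderiv ℝ F x (V x) ∂(μ : Measure U) = 0 := by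
  obtain ⟨α, ν, hα, hν, hνμ⟩ := hμ
  obtain ⟨hFs, hFc, hFU⟩ := hF
  have hF1 : ContDiff ℝ 1 F := hFs.of_le (by norm_cast)
  obtain ⟨hgc, S, hS⟩ := exists_bound_fderiv_apply hV hF1 hFc hFU
  have hDs : ∀ {f : Space n → ℝ} (i : Fin n), ContDiff ℝ ∞ f → ContDiff ℝ ∞ (partialD i f) :=
    fun i hf => (hf.fderiv_right (m := ∞) (by norm_num)).clm_apply contDiff_const
  have hD0 : ∀ {f : Space n → ℝ} (i : Fin n) {x}, x ∉ tsupport f → x ∉ tsupport (partialD i f) :=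
    fun {f} i x hx h => hx (closure_minimal (fun y hy => by
      by_contra hy'
      exact hy (by simp [partialD, fderiv_eq_zero_of_notMem_tsupport hy'])) (isClosed_tsupport f) h)
  have hDD : ∀ i j, Continuous (partialD i (partialD j F)) := fun i j =>
    (hDs i (hDs j hFs)).continuous
  have hDD0 : ∀ i j {x}, x ∉ tsupport F → partialD i (partialD j F) x = 0 := fun i j x hx =>
    image_eq_zero_of_notMem_tsupport (hD0 i (hD0 j hx))
  obtain ⟨T, hT⟩ := hFc.isCompact.exists_bound_of_continuousOn
    (f := fun x => ∑ i, ∑ j, |partialD i (partialD j F) x|)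
    (continuous_finsetSum _ fun i _ => continuous_finsetSum _ fun j _ =>
      (hDD i j).abs).continuousOn
  let g : BoundedContinuousFunction U ℝ :=
    BoundedContinuousFunction.ofNormedAddCommGroup (fun x : U => fderiv ℝ F x (V x)) hgc S hS
  have hlim := (ProbabilityMeasure.tendsto_iff_forall_integral_tendsto.1 hνμ) g
  -- By stationarity the drift integral is minus the diffusion integral. The latter is small, since
  -- the coefficients are uniformly small on the compact support of `F` and `T` bounds the second
  -- derivatives there.
  have hlim0 : Tendsto (fun l => ∫ x, g x ∂(ν l : Measure U)) atTop (𝓝 0) := by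
    refine Metric.tendsto_nhds.2 fun η hη => ?_
    have hη' : 0 < η / (|T| + 1) := by positivity
    filter_upwards [eventually_all.2 fun i => eventually_all.2 fun j =>
      hα.eventually_abs_lt hp hU (fun l => hA (α l)) hFc.isCompact hFU i j hη'] with l hl
    set e : U → ℝ := fun x => ∑ i, ∑ j, A (α l) x i j * partialD i (partialD j F) x
    have hec : Continuous e := continuous_finsetSum _ fun i _ => continuous_finsetSum _ fun j _ =>
      (continuousOn_iff_continuous_domRestrict.1 ((hA (α l)).1 i j).1).mul
        ((hDD i j).comp continuous_subtype_val)
    have heb : ∀ x, ‖e x‖ ≤ η / (|T| + 1) * |T| := fun x => by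
      by_cases hx : (x : Space n) ∈ tsupport F
      · calc ‖e x‖ ≤ ∑ i, ∑ j, ‖A (α l) x i j * partialD i (partialD j F) x‖ :=
              (norm_sum_le _ _).trans (Finset.sum_le_sum fun i _ => norm_sum_le _ _)
          _ ≤ ∑ i, ∑ j, η / (|T| + 1) * |partialD i (partialD j F) x| := by
              refine Finset.sum_le_sum fun i _ => Finset.sum_le_sum fun j _ => ?_
              rw [norm_mul]
              exact mul_le_mul_of_nonneg_right (hl i j x hx).le (abs_nonneg _)
          _ = η / (|T| + 1) * ∑ i, ∑ j, |partialD i (partialD j F) x| := by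
              simp only [Finset.mul_sum]
          _ ≤ _ := mul_le_mul_of_nonneg_left
              ((le_abs_self _).trans ((hT x hx).trans (le_abs_self T))) hη'.le
      · have : e x = 0 := Finset.sum_eq_zero fun i _ => Finset.sum_eq_zero fun j _ => by
          rw [hDD0 i j hx, mul_zero]
        rw [this, norm_zero]; positivity
    have hei : Integrable e (ν l : Measure U) :=
      Integrable.of_bound hec.aestronglyMeasurable _ (Eventually.of_forall heb)
    have hsum : (∫ x, e x ∂(ν l : Measure U)) + ∫ x, g x ∂(ν l : Measure U) = 0 := by
      rw [← integral_add hei (g.integrable _), ← hν l F ⟨hFs, hFc, hFU⟩]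
      refine integral_congr_ae (Eventually.of_forall fun x => ?_)
      simp only [adjointFP, sum_mul_partialD_eq_fderiv]
      rfl
    rw [dist_zero_right, eq_neg_of_add_eq_zero_right hsum, norm_neg]
    calc _ ≤ η / (|T| + 1) * |T| * (ν l : Measure U).real univ :=
          norm_integral_le_of_norm_le_const (Eventually.of_forall heb)
      _ = η * (|T| / (|T| + 1)) := by simp; ring
      _ < η := mul_lt_of_lt_one_right hη ((div_lt_one (by positivity)).2 (by linarith))
  exact tendsto_nhds_unique hlim hlim0

/-- An equation tested with smooth functions may be tested with `C¹` functions. -/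
theorem integral_fderiv_eq_zero_of_contDiff_one {U : Set (Space n)} (hU : IsOpen U)
    {V : Space n → Space n} (hV : ContinuousOn V U) {μ : Measure U} [IsFiniteMeasure μ]
    (hμ : ∀ F, IsTestFunction U F → ∫ x : U, fderiv ℝ F x (V x) ∂μ = 0) {F : Space n → ℝ}
    (hF : ContDiff ℝ 1 F) (hFc : HasCompactSupport F) (hFU : tsupport F ⊆ U) :
    ∫ x : U, fderiv ℝ F x (V x) ∂μ = 0 := by
  obtain ⟨ε₀, hε₀, hε₀U⟩ := hFc.isCompact.exists_cthickening_subset_open hU hFU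
  set K := Metric.cthickening ε₀ (tsupport F)
  have hK : IsCompact K := hFc.isCompact.cthickening
  obtain ⟨M, hM⟩ := hK.exists_bound_of_continuousOn (hV.mono hε₀U)
  have hF' : Continuous (fderiv ℝ F) := hF.continuous_fderiv one_ne_zero
  have hF'u : UniformContinuous (fderiv ℝ F) :=
    (hFc.fderiv ℝ).uniformContinuous_of_continuous hF'
  have key : ∀ δ, 0 < δ → |∫ x : U, fderiv ℝ F x (V x) ∂μ| ≤ δ * (|M| * μ.real univ) := by
    intro δ hδ
    obtain ⟨ε₁, hε₁, hδ'⟩ := Metric.uniformContinuous_iff.1 hF'u δ hδ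
    -- The first bound keeps the support of the mollification in `K ⊆ U`. The second makes its
    -- gradient `δ`-close to that of `F`, the half turning a closed-ball bound into a strict one.
    have hε : 0 < min ε₀ (ε₁ / 2) := lt_min hε₀ (half_pos hε₁)
    let φ : ContDiffBump (0 : Space n) :=
      ⟨min ε₀ (ε₁ / 2) / 2, min ε₀ (ε₁ / 2), half_pos hε, half_lt_self hε⟩
    have hφ : φ.rOut = min ε₀ (ε₁ / 2) := rfl
    set G := mollify volume φ F with hG
    have hGs : ContDiff ℝ ∞ G := contDiff_mollify φ hF.continuous
    have hGK : tsupport G ⊆ K := by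
      refine closure_minimal (fun x hx => ?_) Metric.isClosed_cthickening
      by_contra hxK
      refine hx ?_
      rw [hG, mollify_apply]
      refine integral_eq_zero_of_ae (Eventually.of_forall fun y => ?_)
      by_cases hy : y ∈ Function.support (φ.normed volume)
      · rw [φ.support_normed_eq, mem_ball_zero_iff, hφ] at hy
        have : x - y ∉ tsupport F := fun h => hxK
          (Metric.mem_cthickening_of_dist_le x (x - y) ε₀ _ h (by
            rw [dist_eq_norm, sub_sub_cancel]
            exact hy.le.trans (min_le_left _ _)))
        simp [image_eq_zero_of_notMem_tsupport this]
      · simp [Function.notMem_support.1 hy]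
    have hGc : HasCompactSupport G := hK.of_isClosed_subset (isClosed_tsupport _) hGK
    have hG' : ∀ x, fderiv ℝ G x = mollify volume φ (fderiv ℝ F) x := fun x => by
      have h1 := (hFc.hasFDerivAt_convolution_right (ContinuousLinearMap.lsmul ℝ ℝ)
        ((φ.continuous_normed (μ := volume)).locallyIntegrable (μ := volume)) hF x).fderiv
      rw [show G = convolution (φ.normed volume) F (ContinuousLinearMap.lsmul ℝ ℝ) volume from rfl,
        h1, convolution_def, mollify_apply]
      congr 1
    have hFG : ∀ x, ‖fderiv ℝ G x - fderiv ℝ F x‖ ≤ δ := fun x => by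
      rw [hG']
      refine norm_mollify_sub_le φ hF' fun y hy => ?_
      rw [← dist_eq_norm]
      refine (hδ' ?_).le
      rw [dist_eq_norm, sub_sub_cancel_left, norm_neg]
      exact (hy.trans (hφ ▸ min_le_right _ _)).trans_lt (half_lt_self hε₁)
    have hGt : IsTestFunction U G := ⟨hGs, hGc, hGK.trans hε₀U⟩
    have hint : ∀ H : Space n → ℝ, ContDiff ℝ 1 H → HasCompactSupport H → tsupport H ⊆ U →
        Integrable (fun x : U => fderiv ℝ H x (V x)) μ := fun H h1 h2 h3 => by
      obtain ⟨hc, S, hS⟩ := exists_bound_fderiv_apply hV h1 h2 h3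
      exact Integrable.of_bound hc.aestronglyMeasurable S (Eventually.of_forall hS)
    have h1 : ∫ x : U, fderiv ℝ F x (V x) ∂μ =
        ∫ x : U, (fderiv ℝ F x (V x) - fderiv ℝ G x (V x)) ∂μ := by
      rw [integral_sub (hint F hF hFc hFU) (hint G (hGs.of_le (by norm_cast)) hGc hGt.2.2),
        hμ G hGt, sub_zero]
    rw [h1, ← Real.norm_eq_abs]
    refine (norm_integral_le_of_norm_le_const (C := δ * |M|)
      (Eventually.of_forall fun x => ?_)).trans (le_of_eq (mul_assoc _ _ _))
    by_cases hx : (x : Space n) ∈ K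
    · rw [← sub_apply]
      refine (ContinuousLinearMap.le_opNorm _ _).trans ?_
      rw [norm_sub_rev]
      exact mul_le_mul (hFG x) ((hM x hx).trans (le_abs_self M)) (norm_nonneg _) hδ.le
    · rw [fderiv_eq_zero_of_notMem_tsupport fun h => hx (Metric.self_subset_cthickening _ h),
        fderiv_eq_zero_of_notMem_tsupport fun h => hx (hGK h)]
      simp only [zero_apply, sub_self, norm_zero]
      positivity
  have hlim : Tendsto (fun δ : ℝ => δ * (|M| * μ.real univ)) (𝓝[>] 0)
      (𝓝 (0 * (|M| * μ.real univ))) :=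
    (Continuous.tendsto (by fun_prop) 0).mono_left nhdsWithin_le_nhds
  rw [zero_mul] at hlim
  exact abs_eq_zero.1 (le_antisymm (ge_of_tendsto hlim
    (eventually_mem_nhdsWithin.mono fun δ hδ => key δ hδ)) (abs_nonneg _))

end LimitEquation

/-! ### A limit measure does not charge the region of strict decrease -/

section Lyapunov

theorem hasDerivAt_sq_max_zero (s : ℝ) : HasDerivAt (fun s : ℝ => max s 0 ^ 2) (2 * max s 0) s := by
  rcases lt_trichotomy s 0 with hs | rfl | hs
  · rw [max_eq_right hs.le, mul_zero]
    refine (hasDerivAt_const s (0 : ℝ)).congr_of_eventuallyEq ?_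
    filter_upwards [Iio_mem_nhds hs] with t ht
    simp [max_eq_right (le_of_lt (mem_Iio.1 ht))]
  · rw [hasDerivAt_iff_isLittleO]
    refine Asymptotics.IsBigO.trans_isLittleO (g := fun t : ℝ => t ^ 2) ?_ ?_
    · refine Asymptotics.IsBigO.of_bound 1 (Eventually.of_forall fun t => ?_)
      rcases le_total t 0 with ht | ht <;> simp [ht, sq_nonneg]
    · simpa using (Asymptotics.isLittleO_pow_id (𝕜 := ℝ) one_lt_two)
  · rw [max_eq_left hs.le]
    refine (by simpa using hasDerivAt_pow 2 s :
      HasDerivAt (fun s : ℝ => s ^ 2) (2 * s) s).congr_of_eventuallyEq ?_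
    filter_upwards [Ioi_mem_nhds hs] with t ht
    simp [max_eq_left (le_of_lt (mem_Ioi.1 ht))]

theorem contDiff_sq_max_zero : ContDiff ℝ 1 fun s : ℝ => max s 0 ^ 2 := by
  rw [contDiff_one_iff_deriv]
  refine ⟨fun s => (hasDerivAt_sq_max_zero s).differentiableAt, ?_⟩
  rw [funext fun s => (hasDerivAt_sq_max_zero s).deriv]
  fun_prop

/-- A `C¹` function which is strictly decreasing on `[a, b]`, constant on `(-∞, a]`, and zero on
`[b, ∞)`. -/
noncomputable def levelCutoff (a b s : ℝ) : ℝ := max ((b - a) ^ 2 - max (s - a) 0 ^ 2) 0 ^ 2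

theorem contDiff_levelCutoff (a b : ℝ) : ContDiff ℝ 1 (levelCutoff a b) :=
  contDiff_sq_max_zero.comp
    (contDiff_const.sub (contDiff_sq_max_zero.comp (contDiff_id.sub contDiff_const)))

theorem levelCutoff_eq_zero {a b s : ℝ} (hab : a ≤ b) (hs : b ≤ s) : levelCutoff a b s = 0 := by
  have h1 : max (s - a) 0 = s - a := max_eq_left (by linarith)
  have h2 : (b - a) ^ 2 ≤ (s - a) ^ 2 := pow_le_pow_left₀ (by linarith) (by linarith) 2
  rw [levelCutoff, h1, max_eq_right (by linarith)]
  simp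

/-- These signs make the derivative of the cutoff of `W` along `V` nonnegative everywhere and
positive on `{a < W < b}`. Below level `a`, where nothing is known about `V`, it vanishes. -/
theorem exists_hasDerivAt_levelCutoff {a b : ℝ} (s : ℝ) : ∃ d : ℝ,
    HasDerivAt (levelCutoff a b) d s ∧ d ≤ 0 ∧ (s ≤ a → d = 0) ∧ (a < s → s < b → d < 0) := by
  have h1 := (hasDerivAt_sq_max_zero (s - a)).comp s ((hasDerivAt_id s).sub_const a)
  have h2 := (hasDerivAt_sq_max_zero ((b - a) ^ 2 - max (s - a) 0 ^ 2)).comp s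
    (h1.const_sub ((b - a) ^ 2))
  refine ⟨_, h2, ?_, ?_, ?_⟩
  · rw [mul_one, mul_neg, Left.neg_nonpos_iff]; positivity
  · intro hs
    simp [hs]
  · intro has hsb
    have h3 : max (s - a) 0 = s - a := max_eq_left (by linarith)
    have h4 : 0 < (b - a) ^ 2 - (s - a) ^ 2 := by nlinarith
    rw [h3, max_eq_left h4.le, mul_one, mul_neg, Left.neg_neg_iff]
    have : 0 < s - a := by linarith
    positivity

variable {n : ℕ}

/-- The sublevel sets of a function on a domain. -/
def sublevel (Ω : Set (Space n)) (W : Space n → ℝ) (c : ℝ) : Set (Space n) :=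
  {x | x ∈ Ω ∧ W x ≤ c}

/-- Since `W` tends to its supremum off compact sets, it exceeds `c` outside some compact subset of
`Ω`; the sublevel set is a relatively closed part of that subset. -/
theorem IsCompactFunction.isCompact_sublevel {Ω : Set (Space n)} {W : Space n → ℝ}
    (hW : IsCompactFunction Ω W) {c : ℝ} (hc : (c : EReal) < essUpper Ω W) :
    IsCompact (sublevel Ω W c) := by
  have h1 := hW.2.2.2.eventually (lt_mem_nhds hc)
  obtain ⟨t, ht, htc⟩ := mem_cocompact.1 h1
  have hclosed : IsClosed {x : Ω | W x ≤ c} :=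
    isClosed_le (continuousOn_iff_continuous_domRestrict.1 hW.1.continuousOn) continuous_const
  have hcomp : IsCompact {x : Ω | W x ≤ c} := ht.of_isClosed_subset hclosed fun x hx => by
    by_contra hxt
    have : c < W x := by exact_mod_cast htc hxt
    exact absurd hx (not_le.2 this)
  convert hcomp.image continuous_subtype_val using 1
  ext x
  simp [sublevel, and_comm]

/-- A measure that annihilates derivatives along a vector field does not charge the region where a
compact function strictly decreases along the vector field. -/
theorem measure_lyapunov_eq_zero {U : Set (Space n)} (hU : IsOpen U)
    {V : Space n → Space n} (hV : ContinuousOn V U) {μ : Measure U} [IsFiniteMeasure μ]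
    (hμ : ∀ F, IsTestFunction U F → ∫ x : U, fderiv ℝ F x (V x) ∂μ = 0)
    {Ω : Set (Space n)} (hΩ : IsOpen Ω) (hΩU : Ω ⊆ U) {W : Space n → ℝ}
    (hW : IsCompactFunction Ω W) {a : ℝ}
    (hdec : ∀ x ∈ Ω, a < W x → fderiv ℝ W x (V x) < 0) :
    μ {x : U | (x : Space n) ∈ Ω ∧ a < W x} = 0 := by
  have key : ∀ b : ℝ, a < b → (b : EReal) < essUpper Ω W →
      μ {x : U | (x : Space n) ∈ Ω ∧ a < W x ∧ W x < b} = 0 := by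
    intro b hab hb
    classical
    -- The cutoff vanishes above level `b < ρ_M`, so extension by zero is `C¹` with support in a
    -- compact sublevel set. This is why the equation is needed for `C¹` test functions.
    set F : Space n → ℝ := Ω.indicator fun x => levelCutoff a b (W x) with hF
    have hFW : ∀ x ∈ Ω, F =ᶠ[𝓝 x] fun x => levelCutoff a b (W x) := fun x hx => by
      filter_upwards [hΩ.mem_nhds hx] with y hy
      exact indicator_of_mem hy _
    have hK := hW.isCompact_sublevel hb
    have hts : tsupport F ⊆ sublevel Ω W b := closure_minimal (fun x hx => by
      have hxΩ : x ∈ Ω := by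
        by_contra h; exact hx (indicator_of_notMem h _)
      refine ⟨hxΩ, ?_⟩
      by_contra h
      exact hx (by rw [hF, indicator_of_mem hxΩ, levelCutoff_eq_zero hab.le (not_le.1 h).le]))
      hK.isClosed
    have hWd : ∀ x ∈ Ω, ContDiffAt ℝ 1 W x := fun x hx =>
      ((hW.1 x hx).contDiffAt (hΩ.mem_nhds hx)).of_le (by norm_num)
    have hFs : ContDiff ℝ 1 F := contDiff_of_tsupport fun x hx =>
      ((contDiff_levelCutoff a b).contDiffAt.comp x (hWd x (hts hx).1)).congr_of_eventuallyEq
        (hFW x (hts hx).1)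
    have hFc : HasCompactSupport F := hK.of_isClosed_subset (isClosed_tsupport _) hts
    have hFU : tsupport F ⊆ U := fun x hx => hΩU (hts hx).1
    have hsign : ∀ x : U, 0 ≤ fderiv ℝ F x (V x) ∧
        ((x : Space n) ∈ Ω → a < W x → W x < b → 0 < fderiv ℝ F x (V x)) := by
      intro x
      by_cases hx : (x : Space n) ∈ Ω
      · obtain ⟨d, hd, hd0, hda, hdb⟩ := exists_hasDerivAt_levelCutoff (a := a) (b := b) (W x)
        have h1 : fderiv ℝ F x (V x) = d * fderiv ℝ W x (V x) := by
          rw [(hFW x hx).fderiv_eq, show (fun x => levelCutoff a b (W x)) = levelCutoff a b ∘ W from rfl,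
            (hd.comp_hasFDerivAt (x : Space n)
            ((hWd x hx).differentiableAt (by norm_num)).hasFDerivAt).fderiv]
          simp
        rw [h1]
        refine ⟨?_, fun _ h2 h3 => mul_pos_of_neg_of_neg (hdb h2 h3) (hdec x hx h2)⟩
        rcases le_or_gt (W x) a with h2 | h2
        · rw [hda h2, zero_mul]
        · exact mul_nonneg_of_nonpos_of_nonpos hd0 (hdec x hx h2).le
      · rw [fderiv_eq_zero_of_notMem_tsupport fun h => hx (hts h).1]
        exact ⟨by simp, fun h => absurd h hx⟩
    obtain ⟨hc, S, hS⟩ := exists_bound_fderiv_apply hV hFs hFc hFU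
    have hint : Integrable (fun x : U => fderiv ℝ F x (V x)) μ :=
      Integrable.of_bound hc.aestronglyMeasurable S (Eventually.of_forall hS)
    have hae := (integral_eq_zero_iff_of_nonneg (fun x => (hsign x).1) hint).1
      (integral_fderiv_eq_zero_of_contDiff_one hU hV hμ hFs hFc hFU)
    refine measure_mono_null (fun x hx => ?_) hae
    exact ((hsign x).2 hx.1 hx.2.1 hx.2.2).ne'
  -- Since `W` stays strictly below its supremum, countably many rational levels `b` suffice.
  have hcover : {x : U | (x : Space n) ∈ Ω ∧ a < W x} ⊆
      ⋃ q : ℚ, {x : U | (x : Space n) ∈ Ω ∧ a < W x ∧ W x < q ∧ ((q : ℝ) : EReal) < essUpper Ω W} :=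
    fun x hx => by
      obtain ⟨q, hq1, hq2⟩ := EReal.lt_iff_exists_rat_btwn.1 (hW.2.2.1 x hx.1)
      exact mem_iUnion.2 ⟨q, hx.1, hx.2, by exact_mod_cast hq1, hq2⟩
  refine measure_mono_null hcover (measure_iUnion_null fun q => ?_)
  by_cases hq : a < q ∧ ((q : ℝ) : EReal) < essUpper Ω W
  · refine measure_mono_null ?_ (key q hq.1 hq.2)
    exact fun x hx => ⟨hx.1, hx.2.1, hx.2.2.1⟩
  · convert measure_empty (μ := μ)
    refine eq_empty_of_forall_notMem fun x hx => hq ⟨hx.2.1.trans hx.2.2.1, hx.2.2.2⟩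

end Lyapunov

/-! ### The local flow -/

section LocalFlow

variable {n : ℕ} {U : Set (Space n)} {V : Space n → Space n}

/-- Both curves are compact over a closed interval containing `0` and `t`, so near them `V` can be
replaced by a globally Lipschitz field, for which uniqueness is standard. -/
theorem IsSolution.eq (hU : IsOpen U) (hV : ContDiffOn ℝ 1 V U) {ξ : Space n} {a b a' b' : ℝ}
    {γ γ' : ℝ → Space n} (h : IsSolution U V ξ a b γ) (h' : IsSolution U V ξ a' b' γ') {t : ℝ}
    (ht : t ∈ Ioo a b) (ht' : t ∈ Ioo a' b') : γ t = γ' t := by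
  obtain ⟨ha, hb, h0, hs⟩ := h
  obtain ⟨ha', hb', h0', hs'⟩ := h'
  obtain ⟨c, hc1, hc2⟩ := exists_between (show max a a' < min t 0 from
    max_lt (lt_min ht.1 ha) (lt_min ht'.1 ha'))
  obtain ⟨d, hd1, hd2⟩ := exists_between (show max t 0 < min b b' from
    max_lt (lt_min ht.2 ht'.2) (lt_min hb hb'))
  rw [max_lt_iff] at hc1 hd1
  rw [lt_min_iff] at hc2 hd2
  have hsub : Icc c d ⊆ Ioo a b := fun s hs => ⟨hc1.1.trans_le hs.1, hs.2.trans_lt hd2.1⟩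
  have hsub' : Icc c d ⊆ Ioo a' b' := fun s hs => ⟨hc1.2.trans_le hs.1, hs.2.trans_lt hd2.2⟩
  have hcont : ContinuousOn γ (Icc c d) := fun s h =>
    (hs s (hsub h)).2.continuousAt.continuousWithinAt
  have hcont' : ContinuousOn γ' (Icc c d) := fun s h =>
    (hs' s (hsub' h)).2.continuousAt.continuousWithinAt
  obtain ⟨Y, C, M, hC, -, hY⟩ := exists_lipschitz_bounded_extension
    ((isCompact_Icc.image_of_continuousOn hcont).union
      (isCompact_Icc.image_of_continuousOn hcont')) hU (union_subset
        (image_subset_iff.2 fun s h => (hs s (hsub h)).1)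
        (image_subset_iff.2 fun s h => (hs' s (hsub' h)).1)) hV
  refine ODE_solution_unique_of_mem_Ioo (v := fun _ => Y) (s := fun _ => univ) (K := C)
    (t₀ := 0) (fun t _ => hC.lipschitzOnWith) ⟨hc2.2, hd1.2⟩ (fun s h => ⟨?_, trivial⟩)
    (fun s h => ⟨?_, trivial⟩) (h0.trans h0'.symm) ⟨hc2.1, hd1.1⟩
  · have h' := Ioo_subset_Icc_self h
    rw [hY.self_of_nhdsSet _ (Or.inl (mem_image_of_mem γ h'))]
    exact (hs s (hsub h')).2
  · have h' := Ioo_subset_Icc_self h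
    rw [hY.self_of_nhdsSet _ (Or.inr (mem_image_of_mem γ' h'))]
    exact (hs' s (hsub' h')).2

theorem IsSolution.localFlow_eq (hU : IsOpen U) (hV : ContDiffOn ℝ 1 V U) {ξ : Space n} {a b : ℝ}
    {γ : ℝ → Space n} (h : IsSolution U V ξ a b γ) {t : ℝ} (ht : t ∈ Ioo a b) :
    localFlow U V t ξ = γ t := by
  have hex : ∃ γ : ℝ → Space n, ∃ a b, t ∈ Ioo a b ∧ IsSolution U V ξ a b γ := ⟨γ, a, b, ht, h⟩
  rw [localFlow, dif_pos hex]
  obtain ⟨a', b', ht', h'⟩ := hex.choose_spec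
  exact h'.eq hU hV h ht' ht

theorem IsSolution.neg {ξ : Space n} {a b : ℝ} {γ : ℝ → Space n} (h : IsSolution U V ξ a b γ) :
    IsSolution U (-V) ξ (-b) (-a) fun t => γ (-t) := by
  obtain ⟨ha, hb, h0, hs⟩ := h
  refine ⟨by linarith, by linarith, by simpa using h0, fun t ht => ?_⟩
  have := hs (-t) ⟨by linarith [ht.2], by linarith [ht.1]⟩
  refine ⟨this.1, ?_⟩
  have h2 := this.2.scomp t (hasDerivAt_neg t)
  simpa using! h2

theorem exists_isSolution_neg {ξ : Space n} {t : ℝ} :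
    (∃ γ : ℝ → Space n, ∃ a b, t ∈ Ioo a b ∧ IsSolution U (-V) ξ a b γ) ↔
      ∃ γ : ℝ → Space n, ∃ a b, -t ∈ Ioo a b ∧ IsSolution U V ξ a b γ := by
  constructor
  · rintro ⟨γ, a, b, ht, h⟩
    exact ⟨_, -b, -a, ⟨neg_lt_neg ht.2, neg_lt_neg ht.1⟩, neg_neg V ▸ h.neg⟩
  · rintro ⟨γ, a, b, ht, h⟩
    exact ⟨_, -b, -a, ⟨by linarith [ht.2], by linarith [ht.1]⟩, h.neg⟩

theorem mem_existenceInterval_iff {ξ : Space n} {t : ℝ} : t ∈ existenceInterval U V ξ ↔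
    ∃ γ : ℝ → Space n, ∃ a b, t ∈ Ioo a b ∧ IsSolution U V ξ a b γ :=
  ⟨fun ⟨a, b, γ, h⟩ => ⟨γ, a, b, h⟩, fun ⟨γ, a, b, h⟩ => ⟨a, b, γ, h⟩⟩

theorem mem_existenceInterval_neg {ξ : Space n} {t : ℝ} :
    t ∈ existenceInterval U (-V) ξ ↔ -t ∈ existenceInterval U V ξ := by
  rw [mem_existenceInterval_iff, mem_existenceInterval_iff, exists_isSolution_neg]

theorem localFlow_neg (hU : IsOpen U) (hV : ContDiffOn ℝ 1 V U) (t : ℝ) :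
    localFlow U (-V) t = localFlow U V (-t) := by
  ext1 ξ
  by_cases h : ∃ γ : ℝ → Space n, ∃ a b, -t ∈ Ioo a b ∧ IsSolution U V ξ a b γ
  · obtain ⟨γ, a, b, ht, h⟩ := h
    rw [h.localFlow_eq hU hV ht,
      IsSolution.localFlow_eq (V := -V) hU hV.neg h.neg (t := t)
        ⟨by linarith [ht.2], by linarith [ht.1]⟩]
  · rw [localFlow, dif_neg fun h' => h (exists_isSolution_neg.1 h'), localFlow, dif_neg h]

/-- Maximal repellers are the maximal attractors of the reversed flow. -/
theorem isMaximalRepeller_iff (hU : IsOpen U) (hV : ContDiffOn ℝ 1 V U) {Ω R : Set (Space n)} :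
    IsMaximalRepeller U V Ω R ↔ IsMaximalAttractor U (-V) Ω R := by
  have h1 : IsNegInvariantSet U V Ω ↔ IsPosInvariantSet U (-V) Ω := by
    refine and_congr_right fun _ => and_congr ?_ ?_
    · refine forall₂_congr fun ξ _ => ⟨fun h t ht => ?_, fun h t ht => ?_⟩
      · exact mem_existenceInterval_neg.2 (h (by simpa using ht))
      · exact neg_neg t ▸ mem_existenceInterval_neg.1 (h (a := -t) (by simpa using ht))
    · simp only [localFlow_neg hU hV]
      exact ⟨fun h t ht => h (-t) (by linarith), fun h t ht => by simpa using h (-t) (by linarith)⟩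
  have h2 : IsInvariantSet U V R ↔ IsInvariantSet U (-V) R := by
    refine and_congr_right fun _ => and_congr ?_ ?_
    · refine forall₂_congr fun ξ _ => ?_
      simp only [eq_univ_iff_forall, mem_existenceInterval_neg]
      exact ⟨fun h t => h (-t), fun h t => by simpa using h (-t)⟩
    · simp only [localFlow_neg hU hV]
      exact ⟨fun h t => h (-t), fun h t => by simpa using h (-t)⟩
  have h3 : ∀ K : Set (Space n), ⋃ t ∈ Iic (0 : ℝ), localFlow U V t '' K =
      ⋃ t ∈ Ici (0 : ℝ), localFlow U (-V) t '' K := fun K => by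
    ext x
    simp only [mem_iUnion, exists_prop, localFlow_neg hU hV, mem_Iic, mem_Ici]
    exact ⟨fun ⟨t, ht, h⟩ => ⟨-t, by linarith, by simpa using h⟩,
      fun ⟨t, ht, h⟩ => ⟨-t, by linarith, h⟩⟩
  have h4 : ∀ K : Set (Space n), omegaLimit atBot (localFlow U V) K =
      omegaLimit atTop (localFlow U (-V)) K := fun K => by
    have h5 : ∀ u : Set ℝ, image2 (localFlow U (-V)) u K = image2 (localFlow U V) (-u) K :=
      fun u => by
        ext x
        simp only [mem_image2, localFlow_neg hU hV, Set.mem_neg]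
        exact ⟨fun ⟨t, ht, h⟩ => ⟨-t, by simpa using ht, h⟩,
          fun ⟨t, ht, h⟩ => ⟨-t, ht, by simpa using h⟩⟩
    have h6 : ∀ u : Set ℝ, u ∈ (atTop : Filter ℝ) ↔ -u ∈ (atBot : Filter ℝ) := fun u => by
      rw [← map_neg_atTop, mem_map]; simp
    refine Subset.antisymm ?_ ?_
    · refine subset_iInter₂ fun u hu => ?_
      rw [h5]
      exact biInter_subset_of_mem ((h6 u).1 hu)
    · refine subset_iInter₂ fun u hu => ?_
      have := h5 (-u)
      rw [neg_neg] at this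
      rw [← this]
      exact biInter_subset_of_mem ((h6 (-u)).2 (by rwa [neg_neg]))
  simp only [IsMaximalRepeller, IsMaximalAttractor, h1, h2, h3, h4]

/-- A maximal attractor is contained in any other one. -/
theorem IsMaximalAttractor.subset {Ω J J' : Set (Space n)} (h : IsMaximalAttractor U V Ω J)
    (h' : IsMaximalAttractor U V Ω J') : J ⊆ J' := by
  obtain ⟨-, hJΩ, hJc, hJi, -⟩ := h
  -- An invariant compact `J` lies in its own `ω`-limit set, because `φᵗ(J) = J` at arbitrarily late
  -- times; `J'` attracts that set.
  refine Subset.trans (subset_iInter₂ fun u hu => ?_)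
    (h'.2.2.2.2 J (by rw [IsPrecompactIn, hJc.isClosed.closure_eq]; exact ⟨hJc, hJΩ⟩)).2
  obtain ⟨t, ht⟩ := (atTop : Filter ℝ).nonempty_of_mem hu
  refine Subset.trans ?_ subset_closure
  rw [← hJi.2.2 t]
  rintro _ ⟨x, hx, rfl⟩
  exact mem_image2_of_mem ht ((hJi.2.2 t).symm ▸ hx)

theorem IsGlobalFlow.isSolution {Y : Space n → Space n} {Φ : ℝ → Space n → Space n}
    (hΦ : IsGlobalFlow Y Φ) {ξ : Space n} {a b : ℝ} (ha : a < 0) (hb : 0 < b)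
    (h : ∀ t ∈ Ioo a b, Φ t ξ ∈ U ∧ Y (Φ t ξ) = V (Φ t ξ)) :
    IsSolution U V ξ a b fun t => Φ t ξ :=
  ⟨ha, hb, hΦ.zero ξ, fun t ht => ⟨(h t ht).1, (h t ht).2 ▸ hΦ.hasDerivAt ξ t⟩⟩

end LocalFlow

/-! ### The attractor of a Lyapunov function and the support of the measure -/

section Attractor

variable {n : ℕ} {U Ω : Set (Space n)} {V Y : Space n → Space n} {W : Space n → ℝ}
  {Φ : ℝ → Space n → Space n} {a c ρ γ : ℝ}

theorem sublevel_mono (h : c ≤ ρ) : sublevel Ω W c ⊆ sublevel Ω W ρ :=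
  fun _ hx => ⟨hx.1, hx.2.trans h⟩

theorem hasDerivAt_lyapunov (hΩ : IsOpen Ω) (hW : IsCompactFunction Ω W) (hΦ : IsGlobalFlow Y Φ)
    {x : Space n} {t : ℝ} (hx : Φ t x ∈ Ω) :
    HasDerivAt (fun s => W (Φ s x)) (fderiv ℝ W (Φ t x) (Y (Φ t x))) t :=
  (((hW.1 _ hx).contDiffAt (hΩ.mem_nhds hx)).differentiableAt
    (by norm_num)).hasFDerivAt.comp_hasDerivAt t (hΦ.hasDerivAt x t)

/-- Sublevel sets of a Lyapunov function are forward invariant. -/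
theorem flow_mem_sublevel (hΩ : IsOpen Ω) (hW : IsCompactFunction Ω W) (hΦ : IsGlobalFlow Y Φ)
    (hc : (c : EReal) < essUpper Ω W) (hac : a < c)
    (hdec : ∀ x ∈ sublevel Ω W c, a < W x → fderiv ℝ W x (Y x) < 0)
    {x : Space n} {r t : ℝ} (hx : Φ r x ∈ sublevel Ω W c) (ht : r ≤ t) :
    Φ t x ∈ sublevel Ω W c := by
  have hclosed : IsClosed {s | Φ s x ∈ sublevel Ω W c} :=
    (hW.isCompact_sublevel hc).isClosed.preimage (hΦ.continuous_time x)
  -- Continuous induction in time: the set of good times is closed, and from each of them one can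
  -- continue to the right. On the level `W = c` this holds because the derivative is negative
  -- there, as `a < c`.
  refine IsClosed.mem_of_ge_of_forall_exists_gt
    (a := r) (b := t) (s := {s | Φ s x ∈ sublevel Ω W c}) (hclosed.inter isClosed_Icc) hx ht fun s hs => ?_
  obtain ⟨hsc, hs0, hst⟩ := hs
  have hev : ∀ᶠ r in 𝓝[>] s, Φ r x ∈ sublevel Ω W c := by
    have hΩ' : ∀ᶠ r in 𝓝[>] s, Φ r x ∈ Ω :=
      ((hΦ.continuous_time x).continuousAt.eventually (hΩ.mem_nhds hsc.1)).filter_mono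
        nhdsWithin_le_nhds
    have hd := hasDerivAt_lyapunov hΩ hW hΦ hsc.1
    rcases hsc.2.lt_or_eq with hlt | heq
    · filter_upwards [hΩ', (hd.continuousAt.eventually (gt_mem_nhds hlt)).filter_mono
        nhdsWithin_le_nhds] with r h1 h2
      exact ⟨h1, le_of_lt h2⟩
    · have hneg := hdec _ hsc (heq ▸ hac)
      have hslope := (hasDerivAt_iff_tendsto_slope.1 hd).eventually (gt_mem_nhds hneg)
      filter_upwards [hΩ', hslope.filter_mono (nhdsWithin_mono s fun r hr => ne_of_gt hr),
        self_mem_nhdsWithin] with r h1 h2 h3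
      refine ⟨h1, ?_⟩
      rw [slope_def_field, div_neg_iff] at h2
      have h4 : s < r := h3
      rcases h2 with h2 | h2 <;> linarith [h2.1, h2.2]
  obtain ⟨r, hr1, hr2⟩ := (hev.and (Ioc_mem_nhdsGT hst)).exists
  exact ⟨r, hr1, hr2⟩

/-- Trajectories enter lower sublevel sets of a Lyapunov function within a uniform time. -/
theorem flow_mem_sublevel_of_le (hΩ : IsOpen Ω) (hW : IsCompactFunction Ω W)
    (hΦ : IsGlobalFlow Y Φ) (hγ : 0 < γ) (hρ : (ρ : EReal) < essUpper Ω W) (hac : a < c)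
    (hcρ : c ≤ ρ) (hdec : ∀ x ∈ sublevel Ω W ρ, a < W x → fderiv ℝ W x (Y x) ≤ -γ)
    {x : Space n} (hx : x ∈ sublevel Ω W ρ) {t : ℝ} (ht : (ρ - c) / γ ≤ t) :
    Φ t x ∈ sublevel Ω W c := by
  have ht0 : 0 ≤ t := le_trans (div_nonneg (by linarith) hγ.le) ht
  have hc : (c : EReal) < essUpper Ω W := lt_of_le_of_lt (by exact_mod_cast hcρ) hρ
  have hfwd : ∀ {s}, 0 ≤ s → Φ s x ∈ sublevel Ω W ρ := fun hs =>
    flow_mem_sublevel hΩ hW hΦ hρ (hac.trans_le hcρ)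
      (fun y hy h => (hdec y hy h).trans_lt (by linarith)) (by rwa [hΦ.zero]) hs
  refine ⟨(hfwd ht0).1, ?_⟩
  by_cases hex : ∃ s ∈ Icc 0 t, W (Φ s x) ≤ c
  · obtain ⟨s, hs, hsc⟩ := hex
    exact (flow_mem_sublevel hΩ hW hΦ hc hac
      (fun y hy h => (hdec y (sublevel_mono hcρ hy) h).trans_lt (by linarith))
      ⟨(hfwd hs.1).1, hsc⟩ hs.2).2
  · push Not at hex
    -- As long as `W` stays above `c > a`, it decreases at rate at least `γ`, hence lies below `ρ -
    -- γ s`. At the given time this is at most `c`.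
    have := image_le_of_deriv_right_le_deriv_boundary (f := fun s => W (Φ s x))
      (f' := fun s => fderiv ℝ W (Φ s x) (Y (Φ s x))) (a := 0) (b := t)
      (B := fun s => ρ - γ * s) (B' := fun _ => -γ)
      (fun s hs => (hasDerivAt_lyapunov hΩ hW hΦ
        (hfwd hs.1).1).continuousAt.continuousWithinAt)
      (fun s hs => (hasDerivAt_lyapunov hΩ hW hΦ (hfwd hs.1).1).hasDerivWithinAt)
      (by simpa [hΦ.zero] using hx.2) (by fun_prop)
      (fun s _ => by
        simpa using (((hasDerivAt_id s).const_mul γ).const_sub ρ).hasDerivWithinAt)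
      (fun s hs => hdec _ (hfwd hs.1) (hac.trans (hex s (Ico_subset_Icc_self hs))))
      (right_mem_Icc.2 ht0)
    have h2 : ρ - c ≤ t * γ := (div_le_iff₀ hγ).1 ht
    have h3 : W (Φ t x) ≤ ρ - γ * t := this
    linarith

/-- `Φ` is the global flow of a bounded Lipschitz vector field that agrees with `V` on the sublevel
set `{W ≤ ρ}`; it agrees with the local flow of `V` as long as orbits stay in this set. -/
structure IsSublevelFlow (U : Set (Space n)) (V : Space n → Space n) (Ω : Set (Space n))
    (W : Space n → ℝ) (ρ : ℝ) (Y : Space n → Space n) (Φ : ℝ → Space n → Space n) : Prop where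
  isGlobalFlow : IsGlobalFlow Y Φ
  lipschitz : ∃ C, LipschitzWith C Y
  bounded : ∃ M : NNReal, ∀ x, ‖Y x‖ ≤ M
  eq_on : ∀ x ∈ sublevel Ω W ρ, Y x = V x
  localFlow_eq : ∀ ξ s, s ≤ 0 → Φ s ξ ∈ sublevel Ω W ρ → ∀ t, s ≤ t →
    t ∈ existenceInterval U V ξ ∧ localFlow U V t ξ = Φ t ξ

theorem exists_isSublevelFlow (hU : IsOpen U) (hV : ContDiffOn ℝ 1 V U) (hΩ : IsOpen Ω)
    (hΩU : Ω ⊆ U) (hW : IsCompactFunction Ω W) (hρ : (ρ : EReal) < essUpper Ω W) (haρ : a < ρ)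
    (hdec : ∀ x ∈ Ω, a < W x → fderiv ℝ W x (V x) < 0) :
    ∃ Y Φ, IsSublevelFlow U V Ω W ρ Y Φ := by
  have hK := hW.isCompact_sublevel hρ
  obtain ⟨Y, C, M, hC, hM, hYV⟩ := exists_lipschitz_bounded_extension hK hU
    (fun x hx => hΩU hx.1) hV
  obtain ⟨Φ, hΦ⟩ := exists_isGlobalFlow hC hM
  have hYV' : ∀ x ∈ sublevel Ω W ρ, Y x = V x := fun x hx => hYV.self_of_nhdsSet x hx
  refine ⟨Y, Φ, hΦ, ⟨C, hC⟩, ⟨M, hM⟩, hYV', fun ξ s hs hsξ t hst => ?_⟩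
  have hfwd : ∀ r, s ≤ r → Φ r ξ ∈ sublevel Ω W ρ := fun r hr =>
    flow_mem_sublevel hΩ hW hΦ hρ haρ (fun y hy h => hYV' y hy ▸ hdec y hy.1 h) hsξ hr
  -- Solutions live on open intervals, so the orbit is extended slightly before time `s`. This works
  -- because `Y` and `V` agree on a neighbourhood of the sublevel set.
  have hnear : ∀ᶠ r in 𝓝 s, Φ r ξ ∈ U ∧ Y (Φ r ξ) = V (Φ r ξ) :=
    (hΦ.continuous_time ξ).continuousAt.eventually
      ((hU.eventually_mem (hΩU hsξ.1)).and (eventually_nhdsSet_iff_forall.1 hYV _ hsξ))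
  obtain ⟨ε, hε, hball⟩ := Metric.eventually_nhds_iff.1 hnear
  have hsol : IsSolution U V ξ (s - ε) (|t| + 1) fun t => Φ t ξ :=
    hΦ.isSolution (by linarith) (by positivity) fun r hr => by
      rcases le_or_gt s r with h | h
      · exact ⟨hΩU (hfwd r h).1, hYV' _ (hfwd r h)⟩
      · exact hball (by rw [Real.dist_eq, abs_lt]; constructor <;> linarith [hr.1])
  have ht : t ∈ Ioo (s - ε) (|t| + 1) := ⟨by linarith, by linarith [le_abs_self t]⟩
  exact ⟨⟨_, _, _, ht, hsol⟩, hsol.localFlow_eq hU hV ht⟩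

/-- The set of states in the sublevel set `{W ≤ c}` that are reached at arbitrarily late times. -/
def attractorSet (U : Set (Space n)) (V : Space n → Space n) (Ω : Set (Space n))
    (W : Space n → ℝ) (c : ℝ) : Set (Space n) :=
  ⋂ t ∈ Ici (0 : ℝ), localFlow U V t '' sublevel Ω W c

namespace IsSublevelFlow

theorem localFlow_eq_of_nonneg (h : IsSublevelFlow U V Ω W ρ Y Φ) {ξ : Space n}
    (hξ : ξ ∈ sublevel Ω W ρ) {t : ℝ} (ht : 0 ≤ t) :
    t ∈ existenceInterval U V ξ ∧ localFlow U V t ξ = Φ t ξ :=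
  h.localFlow_eq ξ 0 le_rfl (by rwa [h.isGlobalFlow.zero]) t ht

theorem add (h : IsSublevelFlow U V Ω W ρ Y Φ) (s t : ℝ) (x : Space n) :
    Φ (s + t) x = Φ s (Φ t x) :=
  h.lipschitz.elim fun _ hC => h.isGlobalFlow.add hC s t x

theorem continuous (h : IsSublevelFlow U V Ω W ρ Y Φ) {t : ℝ} (ht : 0 ≤ t) : Continuous (Φ t) :=
  h.lipschitz.elim fun _ hC => h.isGlobalFlow.continuous_space hC ht

theorem injective (h : IsSublevelFlow U V Ω W ρ Y Φ) (t : ℝ) : Function.Injective (Φ t) :=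
  h.lipschitz.elim fun _ hC => h.isGlobalFlow.injective hC t

/-- The set is defined by the local flow, so every truncation above level `c` computes the same set.
Different truncations can therefore be used for different initial data. -/
theorem attractorSet_eq (h : IsSublevelFlow U V Ω W ρ Y Φ) (hcρ : c ≤ ρ) :
    attractorSet U V Ω W c = ⋂ t ∈ Ici (0 : ℝ), Φ t '' sublevel Ω W c :=
  iInter₂_congr fun _ ht => image_congr fun _ hx =>
    (h.localFlow_eq_of_nonneg (sublevel_mono hcρ hx) ht).2

theorem mem_attractorSet (h : IsSublevelFlow U V Ω W ρ Y Φ) (hcρ : c ≤ ρ) {x : Space n} :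
    x ∈ attractorSet U V Ω W c ↔ ∀ t, 0 ≤ t → x ∈ Φ t '' sublevel Ω W c := by
  rw [h.attractorSet_eq hcρ, mem_iInter₂]; rfl

theorem mapsTo_sublevel (h : IsSublevelFlow U V Ω W ρ Y Φ) (hΩ : IsOpen Ω)
    (hW : IsCompactFunction Ω W) (hρ : (ρ : EReal) < essUpper Ω W) (hac : a < c) (hcρ : c ≤ ρ)
    (hdec : ∀ x ∈ Ω, a < W x → fderiv ℝ W x (V x) < 0) {t : ℝ} (ht : 0 ≤ t) :
    MapsTo (Φ t) (sublevel Ω W c) (sublevel Ω W c) := fun x hx =>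
  flow_mem_sublevel hΩ hW h.isGlobalFlow (lt_of_le_of_lt (by exact_mod_cast hcρ) hρ) hac
    (fun y hy h' => h.eq_on y (sublevel_mono hcρ hy) ▸ hdec y hy.1 h')
    (by rwa [h.isGlobalFlow.zero]) ht

/-- Forward invariance of the sublevel set gives one inclusion. For the other, injectivity of `Φ s`
forces the preimages found at different times to coincide. Negative times follow by inverting the
flow. -/
theorem image_attractorSet (h : IsSublevelFlow U V Ω W c Y Φ)
    (hB : ∀ t, 0 ≤ t → MapsTo (Φ t) (sublevel Ω W c) (sublevel Ω W c)) (t : ℝ) :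
    Φ t '' attractorSet U V Ω W c = attractorSet U V Ω W c := by
  have hpos : ∀ s, 0 ≤ s → Φ s '' attractorSet U V Ω W c = attractorSet U V Ω W c := by
    intro s hs
    refine Subset.antisymm ?_ fun y hy => ?_
    · rintro _ ⟨x, hx, rfl⟩
      rw [h.mem_attractorSet le_rfl] at hx ⊢
      intro t ht
      obtain ⟨b, hb, rfl⟩ := hx t ht
      exact ⟨Φ s b, hB s hs hb, by rw [← h.add, ← h.add, add_comm]⟩
    · rw [h.mem_attractorSet le_rfl] at hy
      obtain ⟨x, -, rfl⟩ := hy s hs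
      refine mem_image_of_mem _ ((h.mem_attractorSet le_rfl).2 fun t ht => ?_)
      obtain ⟨b, hb, hbx⟩ := hy (s + t) (by positivity)
      rw [h.add] at hbx
      exact ⟨b, hb, h.injective s hbx⟩
  rcases le_total 0 t with ht | ht
  · exact hpos t ht
  · conv_lhs => rw [← hpos (-t) (by linarith)]
    rw [image_image]
    simp [← h.add, h.isGlobalFlow.zero]

end IsSublevelFlow

/-- The maximal attractor determined by a Lyapunov function. -/
theorem isMaximalAttractor_attractorSet (hU : IsOpen U) (hV : ContDiffOn ℝ 1 V U) (hΩ : IsOpen Ω)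
    (hΩU : Ω ⊆ U) (hW : IsCompactFunction Ω W) (hc : (c : EReal) < essUpper Ω W) (hac : a < c)
    (hγ : 0 < γ) (hdec : ∀ x ∈ Ω, a < W x → fderiv ℝ W x (V x) ≤ -γ) :
    IsMaximalAttractor U V Ω (attractorSet U V Ω W c) := by
  have hdec' : ∀ x ∈ Ω, a < W x → fderiv ℝ W x (V x) < 0 := fun x hx h =>
    (hdec x hx h).trans_lt (by linarith)
  -- A truncated field agrees with `V` only on a compact sublevel set, so each initial point and
  -- each pre-compact set gets its own level `ρ`.
  have hflow : ∀ ρ : ℝ, (ρ : EReal) < essUpper Ω W → c ≤ ρ →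
      ∃ Y Φ, IsSublevelFlow U V Ω W ρ Y Φ := fun ρ hρ hcρ =>
    exists_isSublevelFlow hU hV hΩ hΩU hW hρ (hac.trans_le hcρ) hdec'
  obtain ⟨Y, Φ, h⟩ := hflow c hc le_rfl
  have hBc := hW.isCompact_sublevel hc
  have hB : ∀ t, 0 ≤ t → MapsTo (Φ t) (sublevel Ω W c) (sublevel Ω W c) := fun t ht =>
    h.mapsTo_sublevel hΩ hW hc hac le_rfl hdec' ht
  have hJB : attractorSet U V Ω W c ⊆ sublevel Ω W c := fun x hx => by
    obtain ⟨y, hy, rfl⟩ := (h.mem_attractorSet le_rfl).1 hx 0 le_rfl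
    exact hB 0 le_rfl hy
  have hJΩ : attractorSet U V Ω W c ⊆ Ω := fun x hx => (hJB hx).1
  have himg := h.image_attractorSet hB
  -- Backward orbits of the truncated flow remain in the attractor, where the fields agree, so they
  -- are genuine orbits of `V` for all times.
  have hJflow : ∀ ξ ∈ attractorSet U V Ω W c, ∀ t,
      t ∈ existenceInterval U V ξ ∧ localFlow U V t ξ = Φ t ξ := fun ξ hξ t =>
    h.localFlow_eq ξ (min t 0) (min_le_right _ _)
      (hJB (himg (min t 0) ▸ mem_image_of_mem _ hξ)) t (min_le_left _ _)
  refine ⟨⟨hΩU, fun ξ hξ t ht => ?_, fun t ht => ?_⟩, hJΩ, ?_, ⟨hJΩ.trans hΩU, fun ξ hξ =>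
    eq_univ_iff_forall.2 fun t => (hJflow ξ hξ t).1, fun t => ?_⟩, fun K hK => ?_⟩
  · obtain ⟨Y', Φ', h'⟩ := hflow (max (W ξ) c) (by
      rcases max_choice (W ξ) c with e | e <;> rw [e]
      exacts [hW.2.2.1 ξ hξ, hc]) (le_max_right _ _)
    exact (h'.localFlow_eq_of_nonneg ⟨hξ, le_max_left _ _⟩ ht).1
  · rintro _ ⟨ξ, hξ, rfl⟩
    have hρ : ((max (W ξ) c : ℝ) : EReal) < essUpper Ω W := by
      rcases max_choice (W ξ) c with e | e <;> rw [e]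
      exacts [hW.2.2.1 ξ hξ, hc]
    obtain ⟨Y', Φ', h'⟩ := hflow _ hρ (le_max_right _ _)
    have hξ' : ξ ∈ sublevel Ω W (max (W ξ) c) := ⟨hξ, le_max_left _ _⟩
    rw [(h'.localFlow_eq_of_nonneg hξ' ht).2]
    exact (h'.mapsTo_sublevel hΩ hW hρ (hac.trans_le (le_max_right _ _)) le_rfl hdec' ht hξ').1
  · rw [h.attractorSet_eq le_rfl] at hJB ⊢
    exact hBc.of_isClosed_subset (isClosed_biInter fun t ht =>
      (hBc.image (h.continuous ht)).isClosed) hJB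
  · conv_rhs => rw [← himg t]
    exact image_congr fun ξ hξ => (hJflow ξ hξ t).2
  · obtain ⟨ρ, hρ, hcρ, hKρ⟩ : ∃ ρ : ℝ, (ρ : EReal) < essUpper Ω W ∧ c ≤ ρ ∧
        K ⊆ sublevel Ω W ρ := by
      rcases K.eq_empty_or_nonempty with rfl | hne
      · exact ⟨c, hc, le_rfl, empty_subset _⟩
      · obtain ⟨z, hz, hmax⟩ := hK.1.exists_isMaxOn hne.closure (hW.1.continuousOn.mono hK.2)
        refine ⟨max (W z) c, ?_, le_max_right _ _, fun x hx =>
          ⟨hK.2 (subset_closure hx), (hmax (subset_closure hx)).trans (le_max_left _ _)⟩⟩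
        rcases max_choice (W z) c with e | e <;> rw [e]
        exacts [hW.2.2.1 z (hK.2 hz), hc]
    obtain ⟨Y', Φ', h'⟩ := hflow ρ hρ hcρ
    have hρc := hW.isCompact_sublevel hρ
    constructor
    · have hsub : ⋃ t ∈ Ici (0 : ℝ), localFlow U V t '' K ⊆ sublevel Ω W ρ := by
        refine iUnion₂_subset fun t ht => ?_
        rintro _ ⟨x, hx, rfl⟩
        rw [(h'.localFlow_eq_of_nonneg (hKρ hx) ht).2]
        exact h'.mapsTo_sublevel hΩ hW hρ (hac.trans_le hcρ) le_rfl hdec' ht (hKρ hx)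
      have hcl := closure_minimal hsub hρc.isClosed
      exact ⟨hρc.of_isClosed_subset isClosed_closure hcl, fun x hx => hΩU (hcl hx).1⟩
    · intro x hx
      rw [h'.attractorSet_eq hcρ]
      refine mem_iInter₂.2 fun t (ht : 0 ≤ t) => ?_
      -- After the waiting time `(ρ - c) / γ` the orbits are in `{W ≤ c}`; a further time `t` puts
      -- them in the closed image `Φ' t '' {W ≤ c}`.
      have hx' := mem_iInter₂.1 hx (Ici (t + (ρ - c) / γ)) (Ici_mem_atTop _)
      refine closure_minimal ?_ ((hW.isCompact_sublevel hc).image (h'.continuous ht)).isClosed hx'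
      rintro _ ⟨s, hs, ξ, hξ, rfl⟩
      have hs' : (ρ - c) / γ ≤ s - t := by linarith [mem_Ici.1 hs]
      have hs0 : 0 ≤ s := by
        have : 0 ≤ (ρ - c) / γ := div_nonneg (by linarith) hγ.le
        linarith
      rw [(h'.localFlow_eq_of_nonneg (hKρ hξ) hs0).2]
      refine ⟨Φ' (s - t) ξ, flow_mem_sublevel_of_le hΩ hW h'.isGlobalFlow hγ hρ hac hcρ
        (fun y hy h'' => h'.eq_on y hy ▸ hdec y hy.1 h'') (hKρ hξ) hs', ?_⟩
      rw [← h'.add, add_sub_cancel]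

/-- A measure that annihilates derivatives along a vector field is supported, within the domain of
a Lyapunov function, by the attractor. -/
theorem measure_compl_attractorSet (hU : IsOpen U) (hV : ContDiffOn ℝ 1 V U) (hΩ : IsOpen Ω)
    (hΩU : Ω ⊆ U) (hW : IsCompactFunction Ω W) (hc : (c : EReal) < essUpper Ω W) (hac : a < c)
    (hdec : ∀ x ∈ Ω, a < W x → fderiv ℝ W x (V x) < 0)
    {μ : Measure U} [IsFiniteMeasure μ]
    (hμ : ∀ F, IsTestFunction U F → ∫ x : U, fderiv ℝ F x (V x) ∂μ = 0) :
    μ (Subtype.val ⁻¹' (Ω \ attractorSet U V Ω W c)) = 0 := by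
  obtain ⟨Y, Φ, h⟩ := exists_isSublevelFlow hU hV hΩ hΩU hW hc hac hdec
  have hBc := hW.isCompact_sublevel hc
  set B := sublevel Ω W c with hBdef
  have hB : ∀ t, 0 ≤ t → MapsTo (Φ t) B B := fun t ht =>
    h.mapsTo_sublevel hΩ hW hc hac le_rfl hdec ht
  have hnull : μ {x : U | (x : Space n) ∈ Ω ∧ a < W x} = 0 :=
    measure_lyapunov_eq_zero hU hV.continuousOn hμ hΩ hΩU hW hdec
  have hemb : MeasurableEmbedding (Subtype.val : U → Space n) :=
    MeasurableEmbedding.subtype_coe hU.measurableSet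
  have hΩm : MeasurableSet (Subtype.val ⁻¹' Ω : Set U) := measurable_subtype_coe hΩ.measurableSet
  -- The restriction of `μ` to `Ω`, seen as a measure on the whole space and concentrated on `B`, is
  -- the one to which flow invariance applies.
  set ν : Measure (Space n) := (μ.restrict (Subtype.val ⁻¹' Ω)).map Subtype.val with hν
  have hνapply : ∀ S, ν S = μ (Subtype.val ⁻¹' S ∩ Subtype.val ⁻¹' Ω) := fun S => by
    rw [hν, hemb.map_apply, Measure.restrict_apply' hΩm]
  have hνB : ν Bᶜ = 0 := by
    rw [hνapply]
    refine measure_mono_null ?_ hnull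
    refine fun x hx => ⟨hx.2, ?_⟩
    by_contra hax
    exact hx.1 ⟨hx.2, (not_lt.1 hax).trans hac.le⟩
  -- Multiplying `G` by a cutoff supported in `Ω` and equal to one near `B` gives a test function on
  -- `U`. Off `Ω` its derivative vanishes, and almost every point of `Ω` is in `B`.
  have hνY : ∀ G : Space n → ℝ, ContDiff ℝ ∞ G → ∫ x, fderiv ℝ G x (Y x) ∂ν = 0 := by
    intro G hG
    obtain ⟨χ, hχ, hχc, hχΩ, hχ1⟩ := exists_contDiff_cutoff hBc hΩ fun x hx => hx.1
    have hts : tsupport (fun x => χ x * G x) ⊆ tsupport χ :=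
      closure_mono fun x hx h0 => hx (by simp [h0])
    have hF : IsTestFunction U fun x => χ x * G x :=
      ⟨hχ.mul hG, hχc.of_isClosed_subset (isClosed_tsupport _) hts, hts.trans (hχΩ.trans hΩU)⟩
    rw [hν, hemb.integral_map, ← integral_indicator hΩm, ← hμ _ hF]
    refine integral_congr_ae ?_
    filter_upwards [measure_eq_zero_iff_ae_notMem.1 hnull] with x hx
    by_cases hxΩ : (x : Space n) ∈ Ω
    · have hxB : (x : Space n) ∈ B := by
        refine ⟨hxΩ, le_of_not_gt fun h' => hx ⟨hxΩ, hac.trans h'⟩⟩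
      have heq : (fun x => χ x * G x) =ᶠ[𝓝 (x : Space n)] G := by
        filter_upwards [eventually_nhdsSet_iff_forall.1 hχ1 _ hxB] with y hy
        rw [hy, one_mul]
      rw [indicator_of_mem (show x ∈ Subtype.val ⁻¹' Ω from hxΩ), heq.fderiv_eq, h.eq_on _ hxB]
    · rw [indicator_of_notMem (show x ∉ Subtype.val ⁻¹' Ω from hxΩ),
        fderiv_eq_zero_of_notMem_tsupport fun h' => hxΩ (hχΩ (hts h'))]
      simp
  obtain ⟨C, hC⟩ := h.lipschitz
  obtain ⟨M, hM⟩ := h.bounded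
  -- Invariance gives `ν B ≤ ν (Φ k '' B)`, while the image is contained in `B`. Integer times
  -- suffice because the images are nested.
  have himg : ∀ k : ℕ, ν (B \ Φ k '' B) = 0 := fun k => by
    have hk : (0 : ℝ) ≤ k := Nat.cast_nonneg k
    have hle := measure_le_measure_flow_image hBc hνB h.isGlobalFlow hC hM hνY hBc hk
    rw [measure_sdiff (hB k hk).image_subset
      (hBc.image (h.continuous hk)).isClosed.measurableSet.nullMeasurableSet (measure_ne_top _ _)]
    exact tsub_eq_zero_of_le hle
  have hsub : (attractorSet U V Ω W c)ᶜ ⊆ Bᶜ ∪ ⋃ k : ℕ, B \ Φ k '' B := by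
    intro x hx
    by_cases hxB : x ∈ B
    · refine Or.inr ?_
      by_contra hno
      refine hx ((h.mem_attractorSet le_rfl).2 fun t ht => ?_)
      obtain ⟨k, hk⟩ := exists_nat_ge t
      have hxk : x ∈ Φ k '' B := by
        by_contra hxk
        exact hno (mem_iUnion.2 ⟨k, hxB, hxk⟩)
      obtain ⟨b, hb, rfl⟩ := hxk
      exact ⟨Φ (k - t) b, hB _ (by linarith) hb, by rw [← h.add, add_sub_cancel]⟩
    · exact Or.inl hxB
  have hJ : ν (attractorSet U V Ω W c)ᶜ = 0 :=
    measure_mono_null hsub (measure_union_null hνB (measure_iUnion_null himg))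
  rw [hνapply] at hJ
  refine measure_mono_null ?_ hJ
  exact fun x hx => ⟨hx.2, hx.1⟩

/-- Existence and uniqueness of the maximal attractor, and the support of annihilating measures. -/
theorem existsUnique_attractor_and_measure (hU : IsOpen U) (hV : ContDiffOn ℝ 1 V U)
    (hΩ : IsOpen Ω) (hΩU : Ω ⊆ U) (hW : IsCompactFunction Ω W)
    (ha : (a : EReal) < essUpper Ω W) (hγ : 0 < γ)
    (hdec : ∀ x ∈ Ω, a < W x → fderiv ℝ W x (V x) ≤ -γ) {μ : Measure U} [IsFiniteMeasure μ]
    (hμ : ∀ F, IsTestFunction U F → ∫ x : U, fderiv ℝ F x (V x) ∂μ = 0) :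
    (∃! J, IsMaximalAttractor U V Ω J) ∧
      ∀ J, IsMaximalAttractor U V Ω J → μ (Subtype.val ⁻¹' (Ω \ J)) = 0 := by
  obtain ⟨c, hac, hc⟩ := EReal.lt_iff_exists_real_btwn.1 ha
  have hac' : a < c := by exact_mod_cast hac
  have hJ := isMaximalAttractor_attractorSet hU hV hΩ hΩU hW hc hac' hγ hdec
  have huniq : ∀ J, IsMaximalAttractor U V Ω J → J = attractorSet U V Ω W c := fun J h =>
    (h.subset hJ).antisymm (hJ.subset h)
  refine ⟨⟨_, hJ, huniq⟩, fun J h => ?_⟩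
  rw [huniq J h]
  exact measure_compl_attractorSet hU hV hΩ hΩU hW hc hac'
    (fun x hx h => (hdec x hx h).trans_lt (by linarith)) hμ

/-- By continuity `{W > ρ}` is open, so it misses the closure of `{W < ρ}`. Only the strict
inequality is needed, since all levels used lie above `ρ_m`. -/
theorem mem_essDomain_of_lt (hΩ : IsOpen Ω) (hW : ContinuousOn W Ω) {x : Space n} (hx : x ∈ Ω)
    (h : ρ < W x) : x ∈ essDomain Ω W ρ := by
  refine ⟨hx, fun hcl => ?_⟩
  have hev : ∀ᶠ y in 𝓝 x, ρ < W y := (hW.continuousAt (hΩ.mem_nhds hx)).eventually (lt_mem_nhds h)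
  obtain ⟨y, hy1, hy2⟩ := (mem_closure_iff_frequently.1 hcl).and_eventually hev |>.exists
  exact lt_asymm hy1.2 hy2

end Attractor

end LimitMeasure

/-! ### The limit inequalities and the reduction of repellers to attractors -/

theorem mainTheorem5 {n m : ℕ} {p : ℝ} (hp : (n : ℝ) < p)
    {U : Set (LimitMeasure.Space n)} (hU : IsOpen U) (hUc : IsConnected U)
    {V : LimitMeasure.Space n → LimitMeasure.Space n} (hV : ContDiffOn ℝ 1 V U)
    {ι : Type*} [Preorder ι] [IsDirectedOrder ι] [Nonempty ι]
    {A : ι → LimitMeasure.Space n → Matrix (Fin n) (Fin n) ℝ}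
    (hA : LimitMeasure.IsNullFamily m U p A)
    (hadm : LimitMeasure.IsAdmissible U V A)
    {μ : ProbabilityMeasure U} (hμ : LimitMeasure.IsLimitMeasure U p V A μ)
    {Ω : Set (LimitMeasure.Space n)} (hΩ : IsOpen Ω) (hΩc : IsConnected Ω) (hΩU : Ω ⊆ U) :
    ((∃ W, LimitMeasure.IsUniformLyapunov Ω V A W) →
      (∃! J, LimitMeasure.IsMaximalAttractor U V Ω J) ∧
      ∀ J, LimitMeasure.IsMaximalAttractor U V Ω J →
        (μ : Measure U) (Subtype.val ⁻¹' (Ω \ J)) = 0) ∧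
    (LimitMeasure.IsPrecompactIn U Ω →
      (∃ W, LimitMeasure.IsUniformAntiLyapunov Ω V A W) →
      (∃! R, LimitMeasure.IsMaximalRepeller U V Ω R) ∧
      ∀ R, LimitMeasure.IsMaximalRepeller U V Ω R →
        (μ : Measure U) (Subtype.val ⁻¹' (Ω \ R)) = 0) := by
  have hstat := fun F hF => hμ.integral_fderiv_eq_zero hU hp hV.continuousOn hA.1 (F := F) hF
  obtain ⟨α, -, hα, -, -⟩ := hμ
  have hlim := fun (W : LimitMeasure.Space n → ℝ) x hx =>
    LimitMeasure.tendsto_adjointFP hU hp (V := V) hα (fun l => hA.1 (α l)) W (x := x) hx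
  constructor
  · rintro ⟨W, hW, ρ, γ, -, hρ, hγ, h⟩
    exact LimitMeasure.existsUnique_attractor_and_measure hU hV hΩ hΩU hW hρ hγ
      (fun x hx hρx => le_of_tendsto' (hlim W x (hΩU hx)) fun l =>
        h (α l) x (LimitMeasure.mem_essDomain_of_lt hΩ hW.1.continuousOn hx hρx)) hstat
  · rintro - ⟨W, hW, ρ, γ, -, hρ, hγ, h⟩
    -- In the limit `DW(V) ≥ γ`, so `W` decreases along `-V` and the attractor result applies to the
    -- reversed flow. The equation `∫ DF(V) dμ = 0` is unchanged by the sign.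
    simp only [LimitMeasure.isMaximalRepeller_iff hU hV]
    refine LimitMeasure.existsUnique_attractor_and_measure hU (V := -V) hV.neg hΩ hΩU hW hρ hγ
      (fun x hx hρx => ?_) fun F hF => ?_
    · rw [Pi.neg_apply, map_neg, neg_le_neg_iff]
      exact ge_of_tendsto' (hlim W x (hΩU hx)) fun l =>
        h (α l) x (LimitMeasure.mem_essDomain_of_lt hΩ hW.1.continuousOn hx hρx)
    · simp only [Pi.neg_apply, map_neg]
      rw [integral_neg, hstat F hF, neg_zero]
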